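/- **Setting.** Let $M$ be a compact second countable Hausdorff space and let $M\times M$ be its pair groupoid; the arrow $(x,y)$ has domain $y$ and range $x$. A *Fell bundle* over $M\times M$ is a Banach bundle $E\to M\times M$ (with continuous norm) with a continuous associative bilinear multiplication $E_{(x,y)}\times E_{(y,z)}\to E_{(x,z)}$ and a continuous conjugate linear involution $E_{(x,y)}\to E_{(y,x)}$, such that $\|ab\|\le\|a\|\|b\|$, $a^{**}=a$, $(ab)^*=b^*a^*$, $\|a^*a\|=\|a\|^2$ and $a^*a\ge 0$ in the C*-algebra $E_{(y,y)}$ for $a\in E_{(x,y)}$. It is *saturated* if $E_{(x,y)}E_{(y,z)}$ is total in $E_{(x,z)}$ for all $x,y,z$, and *unital* if every C*-algebra $E_{(x,x)}$ has an identity element. A *Fell bundle triple* $(E,H,PL)$ over $M$ consists of * a unital saturated Fell bundle $E$ over $M\times M$; * a Hilbert space $H$ with a faithful nondegenerate representation of a C*-completion $C^*(E)$ of the convolution $*$-algebra of continuous sections of $E$, where $(f*g)(x,z)=\int f(x,y)g(y,z)\,d\mu(y)$ for a finite Borel measure $\mu$ of full support on $M$ and $f^*(x,y)=f(y,x)^*$,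 and with the compatible representation of the algebra $C^*(E^0)$ of continuous sections of the restriction of $E$ to the units; * a path-lifting operator: a homeomorphism $\varphi$ of $M$ (that is, a global bisection $\{(\varphi(x),x)\}$), a continuous section $x\mapsto e_x\in E_{(\varphi(x),x)}$ of $E$ along it which is consistent, i.e. $\varphi(\varphi(x))=x$ and $e_{\varphi(x)}=e_x^*$, and a bounded operator $PL$ on $H$ which extends the section: $PL$ composed with the action of a section $f$ is the action of the section $(\varphi(x),z)\mapsto e_x f(x,z)$. Morphisms of Fell bundle triples are the continuous, fibrewise linear, multiplicative, involutive, unital bundle maps over continuous maps of the base spaces that carry the first path-lifting section to the second. A *spectral C\*-category* with space of objects $M$ is a C*-category with object space $M$, whose morphisms form a Banach bundle over $M\times M$ (with fibre $\mathrm{Hom}(y,x)$ over $(x,y)$) with continuous composition and involution, which is full (the products of morphisms $x\to y$ and $y\to x$ span a dense subspace of $\mathrm{Hom}(x,x)$ for all $x,y$), together with a continuous section $\sigma$ of the domain map $d$ such that $r\circ\sigma$ is bijective, where $r$ is the range map, and which is self-adjoint: $\sigma(r(\sigma(x)))=\sigma(x)^*$ for all $x$. Morphisms of spectral C*-categories are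 the linear $*$-functors, continuous on objects and on morphisms, that carry the first section to the second. **Proposition.** Let $\mathcal P$ be any class of topological spaces (for example the simply connected compact manifolds, or all spaces), and consider only those $M$ that lie in $\mathcal P$. Assign to a Fell bundle triple $(E,H,PL)$ over $M$ the category with object space $M$, with $\mathrm{Hom}(y,x)=E_{(x,y)}$ and the operations and topology of $E$, and with the section $\sigma(x)=e_x$ that underlies $PL$. This defines a functor from Fell bundle triples to spectral C*-categories, and it is an equivalence of categories. Moreover, the operator and the section correspond to each other: for a given $E$ and a given represented Hilbert space $H$ as above, two path-lifting operators over the same bisection are equal as operators on $H$ if and only if their underlying sections are equal. -/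

import Mathlib

open CategoryTheory Topology MeasureTheory

universe u

/-! ### Banach bundles -/

/-- The total space of a family of fibres (an own structure, so that it carries no default topology). -/
@[ext]
structure Tot {X : Type u} (E : X → Type u) where
  base : X
  val : E base

/-- The fibre product of a family of fibres with itself over the base. -/
structure FibreProd {X : Type u} (E : X → Type u) where
  base : X
  fst : E base
  snd : E base

/-- The fibre product is topologised as a subspace of the square of the total space. -/
instance FibreProd.topology {X : Type u} (E : X → Type u) [TopologicalSpace (Tot E)] :
    TopologicalSpace (FibreProd E) :=
  TopologicalSpace.induced
    (fun p => ((⟨p.base, p.fst⟩ : Tot E), (⟨p.base, p.snd⟩ : Tot E))) inferInstance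

/-- A family of complex Banach spaces, together with a topology on its total space,
is a Banach bundle (with continuous norm). -/
structure IsBanachBundle {X : Type u} [TopologicalSpace X] (E : X → Type u)
    [∀ x, NormedAddCommGroup (E x)] [∀ x, NormedSpace ℂ (E x)] [TopologicalSpace (Tot E)] :
    Prop where
  complete : ∀ x, CompleteSpace (E x)
  continuous_proj : Continuous (Tot.base : Tot E → X)
  isOpenMap_proj : IsOpenMap (Tot.base : Tot E → X)
  continuous_add : Continuous (fun p : FibreProd E => (⟨p.base, p.fst + p.snd⟩ : Tot E))
  continuous_smul : Continuous (fun p : ℂ × Tot E => (⟨p.2.base, p.1 • p.2.val⟩ : Tot E))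
  continuous_norm : Continuous (fun e : Tot E => ‖e.val‖)
  nhds_zero : ∀ x : X, (𝓝 (⟨x, 0⟩ : Tot E)).HasBasis
    (fun p : Set X × ℝ => IsOpen p.1 ∧ x ∈ p.1 ∧ 0 < p.2)
    (fun p => {e : Tot E | e.base ∈ p.1 ∧ ‖e.val‖ < p.2})

/-- The vector space of continuous sections of a Banach bundle. -/
def continuousSections {X : Type u} [TopologicalSpace X] {E : X → Type u}
    [∀ x, NormedAddCommGroup (E x)] [∀ x, NormedSpace ℂ (E x)] [TopologicalSpace (Tot E)]
    (hE : IsBanachBundle E) : Submodule ℂ (∀ x, E x) where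
  carrier := {f | Continuous (fun x => (⟨x, f x⟩ : Tot E))}
  zero_mem' := by
    refine continuous_iff_continuousAt.2 fun x => ?_
    refine (hE.nhds_zero x).tendsto_right_iff.2 fun p hp => ?_
    filter_upwards [hp.1.mem_nhds hp.2.1] with y hy
    exact ⟨hy, by simpa using hp.2.2⟩
  add_mem' := by
    intro f g hf hg
    have h : Continuous (fun x => (⟨x, f x, g x⟩ : FibreProd E)) :=
      continuous_induced_rng.2 (Continuous.prodMk hf hg)
    exact hE.continuous_add.comp h
  smul_mem' := by
    intro c f hf
    exact hE.continuous_smul.comp (Continuous.prodMk continuous_const hf)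

/-! ### Composable arrows over a pair groupoid

The pair groupoid over `M` is `M × M`; the arrow `(x, y)` has range `x` and domain `y`, so that
`(x, y) (y, z) = (x, z)` and `(x, y)⁻¹ = (y, x)`. -/

/-- Pairs of elements of a bundle over the pair groupoid lying over composable arrows. -/
structure Composable {M : Type u} (E : M × M → Type u) where
  x : M
  y : M
  z : M
  left : E (x, y)
  right : E (y, z)

/-- The set of composable pairs is topologised as a subspace of the square of the total space. -/
instance Composable.topology {M : Type u} (E : M × M → Type u) [TopologicalSpace (Tot E)] :
    TopologicalSpace (Composable E) :=
  TopologicalSpace.induced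
    (fun p => ((⟨(p.x, p.y), p.left⟩ : Tot E), (⟨(p.y, p.z), p.right⟩ : Tot E))) inferInstance

/-! ### Fell bundles over pair groupoids -/

/-- A Fell bundle over the pair groupoid `M × M` of a topological space `M`. -/
structure FellBundle (M : Type u) [TopologicalSpace M] where
  Fib : M × M → Type u
  [normed : ∀ g, NormedAddCommGroup (Fib g)]
  [space : ∀ g, NormedSpace ℂ (Fib g)]
  [top : TopologicalSpace (Tot Fib)]
  banach : IsBanachBundle Fib
  mul : ∀ {x y z : M}, Fib (x, y) → Fib (y, z) → Fib (x, z)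
  adj : ∀ {x y : M}, Fib (x, y) → Fib (y, x)
  continuous_mul : Continuous (fun p : Composable Fib => (⟨(p.x, p.z), mul p.left p.right⟩ : Tot Fib))
  continuous_adj : Continuous
    (fun e : Tot Fib => (⟨(e.base.2, e.base.1), adj e.val⟩ : Tot Fib))
  add_mul : ∀ {x y z : M} (a b : Fib (x, y)) (c : Fib (y, z)), mul (a + b) c = mul a c + mul b c
  mul_add : ∀ {x y z : M} (a : Fib (x, y)) (b c : Fib (y, z)), mul a (b + c) = mul a b + mul a c
  smul_mul : ∀ {x y z : M} (t : ℂ) (a : Fib (x, y)) (b : Fib (y, z)), mul (t • a) b = t • mul a b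
  mul_smul : ∀ {x y z : M} (t : ℂ) (a : Fib (x, y)) (b : Fib (y, z)), mul a (t • b) = t • mul a b
  mul_assoc : ∀ {w x y z : M} (a : Fib (w, x)) (b : Fib (x, y)) (c : Fib (y, z)),
    mul (mul a b) c = mul a (mul b c)
  norm_mul_le : ∀ {x y z : M} (a : Fib (x, y)) (b : Fib (y, z)), ‖mul a b‖ ≤ ‖a‖ * ‖b‖
  adj_add : ∀ {x y : M} (a b : Fib (x, y)), adj (a + b) = adj a + adj b
  adj_smul : ∀ {x y : M} (t : ℂ) (a : Fib (x, y)), adj (t • a) = (starRingEnd ℂ t) • adj a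
  adj_adj : ∀ {x y : M} (a : Fib (x, y)), adj (adj a) = a
  adj_mul : ∀ {x y z : M} (a : Fib (x, y)) (b : Fib (y, z)), adj (mul a b) = mul (adj b) (adj a)
  norm_adj_mul : ∀ {x y : M} (a : Fib (x, y)), ‖mul (adj a) a‖ = ‖a‖ ^ 2
  /-- `a* a` is a positive element of the C*-algebra over the unit `(y, y)`. -/
  adj_mul_pos : ∀ {x y : M} (a : Fib (x, y)), ∃ b : Fib (y, y), mul (adj a) a = mul (adj b) b

namespace FellBundle

attribute [instance] FellBundle.normed FellBundle.space FellBundle.top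

variable {M : Type u} [TopologicalSpace M]

/-- `E_g E_h` is total in `E_{gh}` for all composable arrows `g`, `h`. -/
def IsSaturated (E : FellBundle M) : Prop :=
  ∀ x y z : M, Dense (Submodule.span ℂ
    (Set.range (fun p : E.Fib (x, y) × E.Fib (y, z) => E.mul p.1 p.2)) : Set (E.Fib (x, z)))

/-- `u` is an identity element of the C*-algebra over the unit `(x, x)`. -/
def IsIdentity (E : FellBundle M) {x : M} (u : E.Fib (x, x)) : Prop :=
  ∀ a : E.Fib (x, x), E.mul u a = a ∧ E.mul a u = a

/-- Every C*-algebra over a unit of the groupoid has an identity element. -/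
def IsUnital (E : FellBundle M) : Prop :=
  ∀ x : M, ∃ u : E.Fib (x, x), E.IsIdentity u

/-- The identity element of the C*-algebra over `(x, x)`. -/
noncomputable def one (E : FellBundle M) (h : E.IsUnital) (x : M) : E.Fib (x, x) :=
  Classical.choose (h x)

theorem one_isIdentity (E : FellBundle M) (h : E.IsUnital) (x : M) : E.IsIdentity (E.one h x) :=
  Classical.choose_spec (h x)

theorem IsIdentity.eq {E : FellBundle M} {x : M} {u v : E.Fib (x, x)} (hu : E.IsIdentity u)
    (hv : E.IsIdentity v) : u = v :=
  (hv u).2.symm.trans (hu v).1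

theorem sub_mul (E : FellBundle M) {x y z : M} (a b : E.Fib (x, y)) (c : E.Fib (y, z)) :
    E.mul (a - b) c = E.mul a c - E.mul b c := by
  rw [eq_sub_iff_add_eq, ← E.add_mul, sub_add_cancel]

theorem mul_sub (E : FellBundle M) {x y z : M} (a : E.Fib (x, y)) (b c : E.Fib (y, z)) :
    E.mul a (b - c) = E.mul a b - E.mul a c := by
  rw [eq_sub_iff_add_eq, ← E.mul_add, sub_add_cancel]

theorem eq_zero_of_adj_mul (E : FellBundle M) {x y : M} (a : E.Fib (x, y))
    (h : E.mul (E.adj a) a = 0) : a = 0 := by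
  have := E.norm_adj_mul a
  rw [h, norm_zero] at this
  exact norm_eq_zero.1 (pow_eq_zero_iff (two_ne_zero)|>.1 this.symm)

theorem adj_zero (E : FellBundle M) {x y : M} : E.adj (0 : E.Fib (x, y)) = 0 := by
  have := E.adj_add (0 : E.Fib (x, y)) 0
  simpa using this

theorem mul_identity (E : FellBundle M) {x y : M} {u : E.Fib (y, y)} (hu : E.IsIdentity u)
    (a : E.Fib (x, y)) : E.mul a u = a := by
  refine sub_eq_zero.1 (E.eq_zero_of_adj_mul _ ?_)
  rw [E.mul_sub, ← E.mul_assoc, (hu _).2, sub_self]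

theorem identity_mul (E : FellBundle M) {x y : M} {u : E.Fib (x, x)} (hu : E.IsIdentity u)
    (a : E.Fib (x, y)) : E.mul u a = a := by
  have h : E.adj (E.mul u a - a) = 0 := by
    refine E.eq_zero_of_adj_mul _ ?_
    rw [E.adj_adj, E.sub_mul, E.mul_assoc, (hu _).1, sub_self]
  have h2 := E.adj_adj (E.mul u a - a)
  rw [h, E.adj_zero] at h2
  exact sub_eq_zero.1 h2.symm

/-- The involution on the total space. -/
def totAdj (E : FellBundle M) (e : Tot E.Fib) : Tot E.Fib :=
  ⟨(e.base.2, e.base.1), E.adj e.val⟩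

/-- The continuous sections of the bundle; over a compact space all of them are compactly
supported. -/
abbrev sections (E : FellBundle M) : Submodule ℂ (∀ g, E.Fib g) :=
  continuousSections E.banach

/-- The continuous sections of the C*-bundle `E⁰`, the restriction of `E` to the unit space. -/
def IsDiagSection (E : FellBundle M) (a : ∀ x : M, E.Fib (x, x)) : Prop :=
  Continuous (fun x => (⟨(x, x), a x⟩ : Tot E.Fib))

/-- The vector space of continuous sections of the C*-bundle `E⁰`. With pointwise operations and
supremum norm it is the C*-algebra `C*(E⁰)` when `M` is compact. -/
def diagSections (E : FellBundle M) : Submodule ℂ (∀ x : M, E.Fib (x, x)) where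
  carrier := {a | E.IsDiagSection a}
  zero_mem' := by
    have h : Continuous (fun g : M × M => (⟨g, 0⟩ : Tot E.Fib)) := E.sections.zero_mem
    exact h.comp (Continuous.prodMk continuous_id continuous_id)
  add_mem' := by
    intro f g hf hg
    have h : Continuous (fun x => (⟨(x, x), f x, g x⟩ : FibreProd E.Fib)) :=
      continuous_induced_rng.2 (Continuous.prodMk hf hg)
    exact E.banach.continuous_add.comp h
  smul_mem' := by
    intro c f hf
    exact E.banach.continuous_smul.comp (Continuous.prodMk continuous_const hf)

end FellBundle

/-! ### The C*-algebra of a Fell bundle and its representations -/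

/-- A C*-completion `C*(E)` of the convolution algebra of (compactly supported) continuous sections
of `E`, with respect to the Haar system `δ_x × μ` of the pair groupoid. Here the product of `f` and
`g` is `(f * g)(x, z) = ∫ f(x, y) g(y, z) dμ(y)`, which is again a continuous section, and
`f*(x, y) = f(y, x)*`. -/
structure FellBundle.Completion {M : Type u} [TopologicalSpace M] {_ : MeasurableSpace M}
    (E : FellBundle M) (μ : Measure M) where
  Alg : Type u
  [cstar : NonUnitalCStarAlgebra Alg]
  ι : E.sections →ₗ[ℂ] Alg
  injective : Function.Injective ι
  denseRange : DenseRange ι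
  map_conv : ∀ f g h : E.sections,
    (∀ x z : M, h.1 (x, z) = ∫ y, E.mul (f.1 (x, y)) (g.1 (y, z)) ∂μ) → ι h = ι f * ι g
  map_star : ∀ f h : E.sections,
    (∀ x y : M, h.1 (x, y) = E.adj (f.1 (y, x))) → ι h = star (ι f)

attribute [instance] FellBundle.Completion.cstar

/-- A Hilbert space carrying a faithful nondegenerate representation of `C*(E)`, together with the
compatible representation of the diagonal algebra `C*(E⁰)`. -/
structure FellBundle.Representation {M : Type u} [TopologicalSpace M] (E : FellBundle M) where
  /-- The Borel measure giving the Haar system of the pair groupoid: finite, of full support. -/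
  μ : @Measure M (borel M)
  finite : IsFiniteMeasure μ
  openPos : μ.IsOpenPosMeasure
  completion : E.Completion μ
  H : Type u
  [normedH : NormedAddCommGroup H]
  [innerH : InnerProductSpace ℂ H]
  [completeH : CompleteSpace H]
  ρ : completion.Alg →⋆ₙₐ[ℂ] (H →L[ℂ] H)
  faithful : Function.Injective ρ
  nondegenerate : Dense (Submodule.span ℂ
    (Set.range (fun p : completion.Alg × H => ρ p.1 p.2)) : Set H)
  ρ₀ : E.diagSections →ₗ[ℂ] (H →L[ℂ] H)
  ρ₀_mul : ∀ a b c : E.diagSections, (∀ x, c.1 x = E.mul (a.1 x) (b.1 x)) → ρ₀ c = ρ₀ a * ρ₀ b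
  ρ₀_star : ∀ a b : E.diagSections, (∀ x, b.1 x = E.adj (a.1 x)) → ρ₀ b = star (ρ₀ a)
  /-- `C*(E⁰)` acts through its pointwise action on the sections of `E`. -/
  ρ₀_compat : ∀ (a : E.diagSections) (f h : E.sections),
    (∀ x y : M, h.1 (x, y) = E.mul (a.1 x) (f.1 (x, y))) →
      ρ (completion.ι h) = ρ₀ a * ρ (completion.ι f)

attribute [instance] FellBundle.Representation.normedH FellBundle.Representation.innerH
  FellBundle.Representation.completeH

/-- A path-lifting operator: a continuous section of `E` supported on a global bisection
`{(φ x, x)}` of the pair groupoid, extended to a bounded operator on the Hilbert space. The path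
from `x` to `φ x` is lifted to `lift x`; by consistency the reflected path, from `φ x` to `x`, is
lifted to the adjoint of `lift x`. -/
structure FellBundle.PathLifting {M : Type u} [TopologicalSpace M] (E : FellBundle M)
    (R : E.Representation) where
  φ : M ≃ₜ M
  lift : ∀ x : M, E.Fib (φ x, x)
  continuous_lift : Continuous (fun x => (⟨(φ x, x), lift x⟩ : Tot E.Fib))
  consistent : ∀ x : M,
    (⟨(φ (φ x), φ x), lift (φ x)⟩ : Tot E.Fib) = E.totAdj ⟨(φ x, x), lift x⟩
  PL : R.H →L[ℂ] R.H
  /-- The operator extends the section: it acts by multiplying sections of `E` by it. -/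
  extends_lift : ∀ f h : E.sections,
    (∀ x z : M, h.1 (φ x, z) = E.mul (lift x) (f.1 (x, z))) →
      R.ρ (R.completion.ι h) = PL * R.ρ (R.completion.ι f)

/-- The section of the bundle along the bisection, as a map into the total space. -/
def FellBundle.PathLifting.arrow {M : Type u} [TopologicalSpace M] {E : FellBundle M}
    {R : E.Representation} (L : E.PathLifting R) (x : M) : Tot E.Fib :=
  ⟨(L.φ x, x), L.lift x⟩

/-- A Fell bundle triple `(E, H, PL)` whose base is a compact, second countable Hausdorff space
in the class `P` (for instance the class of simply connected manifolds). -/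
structure FellBundleTriple (P : ∀ (M : Type u) [TopologicalSpace M], Prop) where
  M : Type u
  [topM : TopologicalSpace M]
  [compactM : CompactSpace M]
  [t2M : T2Space M]
  [secondCountableM : SecondCountableTopology M]
  base_mem : P M
  E : FellBundle M
  unital : E.IsUnital
  saturated : E.IsSaturated
  R : E.Representation
  L : E.PathLifting R

attribute [instance] FellBundleTriple.topM FellBundleTriple.compactM FellBundleTriple.t2M
  FellBundleTriple.secondCountableM

namespace FellBundleTriple

variable {P : ∀ (M : Type u) [TopologicalSpace M], Prop}

/-- A morphism of Fell bundle triples: a continuous, fibrewise linear, multiplicative, involutive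
and unital bundle map, over a continuous map of the bases, which carries the path-lifting section
of the first triple to that of the second. -/
@[ext]
structure Hom (S T : FellBundleTriple P) where
  base : S.M → T.M
  map : ∀ x y : S.M, S.E.Fib (x, y) →ₗ[ℂ] T.E.Fib (base x, base y)
  continuous_base : Continuous base
  continuous_map : Continuous (fun e : Tot S.E.Fib =>
    (⟨(base e.base.1, base e.base.2), map e.base.1 e.base.2 e.val⟩ : Tot T.E.Fib))
  map_mul : ∀ {x y z : S.M} (a : S.E.Fib (x, y)) (b : S.E.Fib (y, z)),
    map x z (S.E.mul a b) = T.E.mul (map x y a) (map y z b)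
  map_adj : ∀ {x y : S.M} (a : S.E.Fib (x, y)), map y x (S.E.adj a) = T.E.adj (map x y a)
  map_identity : ∀ {x : S.M} (a : S.E.Fib (x, x)), S.E.IsIdentity a → T.E.IsIdentity (map x x a)
  map_lift : ∀ x : S.M,
    (⟨(base (S.L.φ x), base x), map (S.L.φ x) x (S.L.lift x)⟩ : Tot T.E.Fib) = T.L.arrow (base x)

/-- The identity morphism. -/
def Hom.id (S : FellBundleTriple P) : Hom S S where
  base := fun x => x
  map := fun _ _ => LinearMap.id
  continuous_base := continuous_id
  continuous_map := continuous_id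
  map_mul := fun _ _ => rfl
  map_adj := fun _ => rfl
  map_identity := fun _ h => h
  map_lift := fun _ => rfl

/-- Composition of morphisms. -/
def Hom.comp {S T U : FellBundleTriple P} (F : Hom S T) (G : Hom T U) : Hom S U where
  base := fun x => G.base (F.base x)
  map := fun x y => (G.map (F.base x) (F.base y)).comp (F.map x y)
  continuous_base := G.continuous_base.comp F.continuous_base
  continuous_map := G.continuous_map.comp F.continuous_map
  map_mul := fun a b => by simp [F.map_mul, G.map_mul]
  map_adj := fun a => by simp [F.map_adj, G.map_adj]
  map_identity := fun a h => G.map_identity _ (F.map_identity a h)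
  map_lift := fun x => by
    have h1 := congrArg (fun e : Tot T.E.Fib => (⟨(G.base e.base.1, G.base e.base.2),
      G.map e.base.1 e.base.2 e.val⟩ : Tot U.E.Fib)) (F.map_lift x)
    exact h1.trans (G.map_lift (F.base x))

instance : Category.{u} (FellBundleTriple P) where
  Hom := Hom
  id := Hom.id
  comp := Hom.comp

end FellBundleTriple

/-! ### C*-categories -/

/-- A C*-category. -/
class CStarCategory (C : Type u) [Category.{u} C] where
  [normed : ∀ x y : C, NormedAddCommGroup (x ⟶ y)]
  [space : ∀ x y : C, NormedSpace ℂ (x ⟶ y)]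
  complete : ∀ x y : C, CompleteSpace (x ⟶ y)
  add_comp : ∀ {x y z : C} (f g : x ⟶ y) (h : y ⟶ z), (f + g) ≫ h = f ≫ h + g ≫ h
  comp_add : ∀ {x y z : C} (f : x ⟶ y) (g h : y ⟶ z), f ≫ (g + h) = f ≫ g + f ≫ h
  smul_comp : ∀ {x y z : C} (t : ℂ) (f : x ⟶ y) (g : y ⟶ z), (t • f) ≫ g = t • (f ≫ g)
  comp_smul : ∀ {x y z : C} (t : ℂ) (f : x ⟶ y) (g : y ⟶ z), f ≫ (t • g) = t • (f ≫ g)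
  norm_comp_le : ∀ {x y z : C} (f : x ⟶ y) (g : y ⟶ z), ‖f ≫ g‖ ≤ ‖g‖ * ‖f‖
  adj : ∀ {x y : C}, (x ⟶ y) → (y ⟶ x)
  adj_add : ∀ {x y : C} (f g : x ⟶ y), adj (f + g) = adj f + adj g
  adj_smul : ∀ {x y : C} (t : ℂ) (f : x ⟶ y), adj (t • f) = (starRingEnd ℂ t) • adj f
  adj_adj : ∀ {x y : C} (f : x ⟶ y), adj (adj f) = f
  adj_id : ∀ x : C, adj (𝟙 x) = 𝟙 x
  adj_comp : ∀ {x y z : C} (f : x ⟶ y) (g : y ⟶ z), adj (f ≫ g) = adj g ≫ adj f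
  norm_comp_adj : ∀ {x y : C} (f : x ⟶ y), ‖f ≫ adj f‖ = ‖f‖ ^ 2
  comp_adj_pos : ∀ {x y : C} (f : x ⟶ y), ∃ b : x ⟶ x, f ≫ adj f = b ≫ adj b

attribute [reducible] CStarCategory.normed CStarCategory.space

attribute [instance] CStarCategory.normed CStarCategory.space

/-- A C*-category is full if all its hom-bimodules are full: the products of morphisms `x ⟶ y` with
morphisms `y ⟶ x` span a dense subspace of the algebra of endomorphisms of `x`. -/
def CStarCategory.IsFull (C : Type u) [Category.{u} C] [CStarCategory C] : Prop :=
  ∀ x y : C, Dense (Submodule.span ℂ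
    (Set.range (fun p : (x ⟶ y) × (y ⟶ x) => p.1 ≫ p.2)) : Set (x ⟶ x))

/-- The family of homsets `C_{xy} = Hom(y, x)`, indexed by the maximal equivalence relation
on the objects. -/
abbrev HomFam (C : Type u) [Category.{u} C] : C × C → Type u := fun g => (g.2 ⟶ g.1)

/-- A C*-category with a space of objects, fibred over the maximal equivalence relation on it: the
morphisms form a Banach bundle with continuous composition and involution. -/
class FibredCStarCategory (C : Type u) [Category.{u} C] [TopologicalSpace C] extends
    CStarCategory C where
  [top : TopologicalSpace (Tot (HomFam C))]
  banach : IsBanachBundle (HomFam C)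
  continuous_comp : Continuous (fun p : Composable (HomFam C) =>
    (⟨(p.x, p.z), (show p.z ⟶ p.y from p.right) ≫ (show p.y ⟶ p.x from p.left)⟩ : Tot (HomFam C)))
  continuous_adj : Continuous (fun e : Tot (HomFam C) =>
    (⟨(e.base.2, e.base.1), CStarCategory.adj e.val⟩ : Tot (HomFam C)))

attribute [reducible] FibredCStarCategory.top

attribute [instance] FibredCStarCategory.top

namespace Tot

variable {C : Type u} [Category.{u} C]

/-- The domain map of a category. -/
def dom (e : Tot (HomFam C)) : C := e.base.2

/-- The range map of a category. -/
def ran (e : Tot (HomFam C)) : C := e.base.1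

/-- The involution of a C*-category, on the set of all morphisms. -/
def star [CStarCategory C] (e : Tot (HomFam C)) : Tot (HomFam C) :=
  ⟨(e.base.2, e.base.1), CStarCategory.adj e.val⟩

end Tot

/-- A spectral C*-category: a small full C*-category with a continuous global self-adjoint section
`σ` of its domain map such that `r ∘ σ` is bijective. The space of objects is a compact, second
countable Hausdorff space in the class `P`. -/
structure SpectralCStarCategory (P : ∀ (M : Type u) [TopologicalSpace M], Prop) where
  Ob : Type u
  [topOb : TopologicalSpace Ob]
  [compactOb : CompactSpace Ob]
  [t2Ob : T2Space Ob]
  [secondCountableOb : SecondCountableTopology Ob]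
  base_mem : P Ob
  [cat : Category.{u} Ob]
  [cstar : FibredCStarCategory Ob]
  full : CStarCategory.IsFull Ob
  σ : Ob → Tot (HomFam Ob)
  continuous_σ : Continuous σ
  dom_σ : ∀ x, (σ x).dom = x
  bijective_σ : Function.Bijective (fun x => (σ x).ran)
  /-- `σ` equals its adjoint, the section `σ*` with `σ*(r(σ(x))) = σ(x)*`. -/
  selfAdjoint_σ : ∀ x, σ (σ x).ran = (σ x).star

attribute [instance] SpectralCStarCategory.topOb SpectralCStarCategory.compactOb
  SpectralCStarCategory.t2Ob SpectralCStarCategory.secondCountableOb SpectralCStarCategory.cat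
  SpectralCStarCategory.cstar

namespace SpectralCStarCategory

variable {P : ∀ (M : Type u) [TopologicalSpace M], Prop}

/-- The map induced by a functor on the set of all morphisms. -/
def totMap {C D : Type u} [Category.{u} C] [Category.{u} D] (F : C ⥤ D) (e : Tot (HomFam C)) :
    Tot (HomFam D) :=
  ⟨(F.obj e.base.1, F.obj e.base.2), F.map e.val⟩

/-- A morphism of spectral C*-categories: a continuous linear *-functor which carries the section
of the first to that of the second. -/
@[ext]
structure Hom (C D : SpectralCStarCategory P) where
  functor : C.Ob ⥤ D.Ob
  continuous_obj : Continuous functor.obj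
  continuous_map : Continuous (totMap functor)
  map_add : ∀ {x y : C.Ob} (f g : x ⟶ y), functor.map (f + g) = functor.map f + functor.map g
  map_smul : ∀ {x y : C.Ob} (t : ℂ) (f : x ⟶ y), functor.map (t • f) = t • functor.map f
  map_adj : ∀ {x y : C.Ob} (f : x ⟶ y),
    functor.map (CStarCategory.adj f) = CStarCategory.adj (functor.map f)
  map_σ : ∀ x : C.Ob, totMap functor (C.σ x) = D.σ (functor.obj x)

/-- The identity morphism. -/
def Hom.id (C : SpectralCStarCategory P) : Hom C C where
  functor := 𝟭 C.Ob
  continuous_obj := continuous_id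
  continuous_map := continuous_id
  map_add := fun _ _ => rfl
  map_smul := fun _ _ => rfl
  map_adj := fun _ => rfl
  map_σ := fun _ => rfl

/-- Composition of morphisms. -/
def Hom.comp {C D K : SpectralCStarCategory P} (F : Hom C D) (G : Hom D K) : Hom C K where
  functor := F.functor ⋙ G.functor
  continuous_obj := G.continuous_obj.comp F.continuous_obj
  continuous_map := G.continuous_map.comp F.continuous_map
  map_add := fun f g => by simp [F.map_add, G.map_add]
  map_smul := fun t f => by simp [F.map_smul, G.map_smul]
  map_adj := fun f => by simp [F.map_adj, G.map_adj]
  map_σ := fun x => (congrArg (totMap G.functor) (F.map_σ x)).trans (G.map_σ (F.functor.obj x))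

instance : Category.{u} (SpectralCStarCategory P) where
  Hom := Hom
  id := Hom.id
  comp := Hom.comp

end SpectralCStarCategory

/-! ### The spectral C*-category of a Fell bundle triple -/

namespace FellBundle

variable {M : Type u} [TopologicalSpace M]

/-- The category associated to a unital Fell bundle over the pair groupoid of `M`: its objects are
the points of `M`, and the morphisms from `y` to `x` are the elements of the fibre over `(x, y)`. -/
@[reducible]
noncomputable def category (E : FellBundle M) (h : E.IsUnital) : Category.{u} M where
  Hom := fun y x => E.Fib (x, y)
  id := fun x => E.one h x
  comp := fun f g => E.mul g f
  id_comp := fun f => E.mul_identity (E.one_isIdentity h _) f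
  comp_id := fun f => E.identity_mul (E.one_isIdentity h _) f
  assoc := fun f g k => (E.mul_assoc k g f).symm

theorem adj_one (E : FellBundle M) (h : E.IsUnital) (x : M) : E.adj (E.one h x) = E.one h x := by
  have h1 := E.mul_identity (E.one_isIdentity h x) (E.adj (E.one h x))
  have h2 := E.adj_mul (E.adj (E.one h x)) (E.one h x)
  rw [E.adj_adj, h1, E.adj_adj] at h2
  exact h2.symm

/-- The C*-category associated to a unital Fell bundle. -/
@[reducible]
noncomputable def fibredCStarCategory (E : FellBundle M) (h : E.IsUnital) :
    @FibredCStarCategory M (E.category h) _ :=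
  letI := E.category h
  { normed := fun y x => E.normed (x, y)
    space := fun y x => E.space (x, y)
    complete := fun y x => E.banach.complete (x, y)
    add_comp := fun f g k => E.mul_add k f g
    comp_add := fun f g k => E.add_mul g k f
    smul_comp := fun t f g => E.mul_smul t g f
    comp_smul := fun t f g => E.smul_mul t g f
    norm_comp_le := fun f g => E.norm_mul_le g f
    adj := fun f => E.adj f
    adj_add := fun f g => E.adj_add f g
    adj_smul := fun t f => E.adj_smul t f
    adj_adj := fun f => E.adj_adj f
    adj_id := fun x => E.adj_one h x
    adj_comp := fun f g => E.adj_mul g f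
    norm_comp_adj := fun f => E.norm_adj_mul f
    comp_adj_pos := fun f => E.adj_mul_pos f
    top := E.top
    banach := E.banach
    continuous_comp := E.continuous_mul
    continuous_adj := E.continuous_adj }

end FellBundle

namespace FellBundleTriple

variable {P : ∀ (M : Type u) [TopologicalSpace M], Prop}

/-- The spectral C*-category of a Fell bundle triple: the C*-category of the Fell bundle, with the
section underlying the path-lifting operator. -/
noncomputable def spectralCStarCategory (T : FellBundleTriple P) : SpectralCStarCategory P :=
  letI := T.E.category T.unital
  letI := T.E.fibredCStarCategory T.unital
  { Ob := T.M
    base_mem := T.base_mem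
    cat := T.E.category T.unital
    cstar := T.E.fibredCStarCategory T.unital
    full := fun x y => by
      have h := T.saturated x y x
      have hs : Set.range (fun p : T.E.Fib (x, y) × T.E.Fib (y, x) => T.E.mul p.1 p.2)
          = Set.range (fun p : (x ⟶ y) × (y ⟶ x) => p.1 ≫ p.2) := by
        ext a
        constructor
        · rintro ⟨p, rfl⟩
          exact ⟨(p.2, p.1), rfl⟩
        · rintro ⟨p, rfl⟩
          exact ⟨(p.2, p.1), rfl⟩
      rw [hs] at h
      exact h
    σ := fun x => T.L.arrow x
    continuous_σ := T.L.continuous_lift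
    dom_σ := fun _ => rfl
    bijective_σ := T.L.φ.bijective
    selfAdjoint_σ := fun x => T.L.consistent x }

/-- The functor from Fell bundle triples to spectral C*-categories. -/
noncomputable def toSpectral (P : ∀ (M : Type u) [TopologicalSpace M], Prop) :
    FellBundleTriple P ⥤ SpectralCStarCategory P where
  obj := spectralCStarCategory
  map := fun {S T} F =>
    { functor :=
        { obj := F.base
          map := fun {y x} a => F.map x y a
          map_id := fun x => (F.map_identity _ (S.E.one_isIdentity S.unital x)).eq
            (T.E.one_isIdentity T.unital (F.base x))
          map_comp := fun f g => F.map_mul g f }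
      continuous_obj := F.continuous_base
      continuous_map := F.continuous_map
      map_add := fun f g => (F.map _ _).map_add f g
      map_smul := fun t f => (F.map _ _).map_smul t f
      map_adj := fun f => F.map_adj f
      map_σ := fun x => F.map_lift x }

end FellBundleTriple

/-! ### Continuous sections of Banach bundles -/

namespace IsBanachBundle

set_option linter.unusedSectionVars false

variable {X : Type u} [TopologicalSpace X] {E : X → Type u} [∀ x, NormedAddCommGroup (E x)]
  [∀ x, NormedSpace ℂ (E x)] [TopologicalSpace (Tot E)]

/-! Morphisms on the two sides carry the same data, since neither kind involves the Hilbert space or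
the operator; faithfulness and fullness are therefore bookkeeping, the one remark being that an
identity element of a fibre is unique. The substance is essential surjectivity: a spectral
C*-category yields a Fell bundle with a section `e` along a bisection `φ`, but a represented Hilbert
space on which `e` acts as a bounded operator must be built (`exists_representation`).

The measure may be chosen, and it is adapted to `φ`: it is atomic with masses `s(x)²`, where `s` is
summable, has dense support and satisfies `s ∘ φ = s` (`exists_invariant_weight`). The GNS
construction for all positive functionals on the unit fibres represents the fibres faithfully as
operators `K y → K x` (`universalRep`). On the Hilbert sum of the `K x` a section `f` acts as the
matrix with entries `s(x) s(y) π(f(x,y))`, which turns convolution into the matrix product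
(`kernelOp_mul`). A section along `φ` acts by permuting the summands and applying its values, and
invariance of `s` makes this compatible with the matrices (`mul_kernelOp`). Restricting to the
essential subspace gives nondegeneracy; density of the support gives faithfulness.

For the last claim, an operator is determined by its products with the represented sections, by
density and nondegeneracy. Conversely, the operator determines the products `e_x f(x,z)` for all
continuous sections `f`. These determine `e_x` because some `f` has a value close to the identity of
the fibre (`exists_section_near`). Such sections are produced by pasting approximately continuous
local sections with partitions of unity and iterating (`exists_refinement`). -/

theorem exists_nhds_add (hE : IsBanachBundle E) {x : X} {b c : E x} {W : Set (Tot E)}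
    (hW : W ∈ 𝓝 (⟨x, b + c⟩ : Tot E)) :
    ∃ U ∈ 𝓝 (⟨x, b⟩ : Tot E), ∃ V ∈ 𝓝 (⟨x, c⟩ : Tot E), ∀ (y : X) (e f : E y),
      (⟨y, e⟩ : Tot E) ∈ U → (⟨y, f⟩ : Tot E) ∈ V → (⟨y, e + f⟩ : Tot E) ∈ W := by
  have h := (hE.continuous_add.continuousAt (x := ⟨x, b, c⟩)).preimage_mem_nhds hW
  rw [nhds_induced, Filter.mem_comap] at h
  obtain ⟨t, ht, hts⟩ := h
  obtain ⟨U, hU, V, hV, hUV⟩ := mem_nhds_prod_iff.1 ht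
  exact ⟨U, hU, V, hV, fun y e f he hf => hts (a := ⟨y, e, f⟩) (hUV ⟨he, hf⟩)⟩

theorem exists_nhds_smul (hE : IsBanachBundle E) {x : X} {t : ℂ} {b : E x} {W : Set (Tot E)}
    (hW : W ∈ 𝓝 (⟨x, t • b⟩ : Tot E)) :
    ∃ U ∈ 𝓝 t, ∃ V ∈ 𝓝 (⟨x, b⟩ : Tot E), ∀ (y : X) (s : ℂ) (e : E y),
      s ∈ U → (⟨y, e⟩ : Tot E) ∈ V → (⟨y, s • e⟩ : Tot E) ∈ W := by
  have h := (hE.continuous_smul.continuousAt (x := (t, ⟨x, b⟩))).preimage_mem_nhds hW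
  obtain ⟨U, hU, V, hV, hUV⟩ := mem_nhds_prod_iff.1 h
  exact ⟨U, hU, V, hV, fun y s e hs he => hUV (a := (s, ⟨y, e⟩)) ⟨hs, he⟩⟩

/-- Near `x` the (possibly discontinuous) section `s` is within any distance greater than `r` of
elements of the total space close to `b`. -/
def ApproxAt (r : ℝ) (s : ∀ x, E x) (x : X) (b : E x) : Prop :=
  ∀ ε > r, ∀ W ∈ 𝓝 (⟨x, b⟩ : Tot E), ∀ᶠ y in 𝓝 x, ∃ e : E y, (⟨y, e⟩ : Tot E) ∈ W ∧ ‖s y - e‖ < ε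

theorem ApproxAt.mono {r r' : ℝ} {s : ∀ x, E x} {x : X} {b : E x} (h : ApproxAt r s x b)
    (hr : r ≤ r') : ApproxAt r' s x b :=
  fun ε hε W hW => h ε (lt_of_le_of_lt hr hε) W hW

theorem ApproxAt.add (hE : IsBanachBundle E) {r r' : ℝ} {s s' : ∀ x, E x} {x : X} {b b' : E x}
    (h : ApproxAt r s x b) (h' : ApproxAt r' s' x b') :
    ApproxAt (r + r') (fun y => s y + s' y) x (b + b') := by
  intro ε hε W hW
  obtain ⟨U, hU, V, hV, hUV⟩ := hE.exists_nhds_add hW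
  filter_upwards [h (r + (ε - (r + r')) / 2) (by linarith) U hU,
    h' (r' + (ε - (r + r')) / 2) (by linarith) V hV] with y ⟨e, he, hse⟩ ⟨e', he', hse'⟩
  refine ⟨e + e', hUV y e e' he he', ?_⟩
  calc ‖s y + s' y - (e + e')‖ = ‖(s y - e) + (s' y - e')‖ := by congr 1; abel
    _ ≤ ‖s y - e‖ + ‖s' y - e'‖ := norm_add_le _ _
    _ < ε := by linarith

theorem ApproxAt.smul (hE : IsBanachBundle E) {r : ℝ} {s : ∀ x, E x} {x : X} {b : E x}
    (h : ApproxAt r s x b) {ψ : X → ℂ} (hψ : ContinuousAt ψ x) :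
    ApproxAt (‖ψ x‖ * r) (fun y => ψ y • s y) x (ψ x • b) := by
  intro ε hε W hW
  obtain ⟨U, hU, V, hV, hUV⟩ := hE.exists_nhds_smul hW
  -- The slack is divided by `‖ψ x‖ + 1` so that `ψ x = 0` needs no separate case.
  set η := (ε - ‖ψ x‖ * r) / (‖ψ x‖ + 1) with hη
  have h0 : 0 ≤ ‖ψ x‖ := norm_nonneg _
  have hη0 : 0 < η := div_pos (by linarith) (by linarith)
  have hlt : ‖ψ x‖ * (r + η) < ε := by
    have : η * (‖ψ x‖ + 1) = ε - ‖ψ x‖ * r := div_mul_cancel₀ _ (by linarith)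
    nlinarith
  have hev : ∀ᶠ y in 𝓝 x, ‖ψ y‖ * (r + η) < ε :=
    (hψ.norm.mul continuousAt_const).eventually_lt continuousAt_const hlt
  filter_upwards [h (r + η) (by linarith) V hV, hev, hψ hU] with y ⟨e, he, hse⟩ hy hyU
  refine ⟨ψ y • e, hUV y _ e hyU he, ?_⟩
  rw [← smul_sub, norm_smul]
  exact lt_of_le_of_lt (mul_le_mul_of_nonneg_left hse.le (norm_nonneg _)) hy

theorem ApproxAt.of_norm_sub_le {r c : ℝ} {s t : ∀ x, E x} {x : X} {b : E x}
    (h : ApproxAt r s x b) (hst : ∀ y, ‖t y - s y‖ ≤ c) : ApproxAt (r + c) t x b := by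
  intro ε hε W hW
  filter_upwards [h (ε - c) (by linarith) W hW] with y ⟨e, he, hse⟩
  refine ⟨e, he, ?_⟩
  calc ‖t y - e‖ = ‖(t y - s y) + (s y - e)‖ := by congr 1; abel
    _ ≤ ‖t y - s y‖ + ‖s y - e‖ := norm_add_le _ _
    _ < ε := by linarith [hst y]

theorem approxAt_zero_of_eventuallyEq {s : ∀ x, E x} {x : X} (hE : IsBanachBundle E)
    (hs : ∀ᶠ y in 𝓝 x, s y = 0) : ApproxAt 0 s x 0 := by
  intro ε hε W hW
  have hc : Continuous (fun x => (⟨x, 0⟩ : Tot E)) := (continuousSections hE).zero_mem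
  filter_upwards [hs, hc.continuousAt.preimage_mem_nhds hW] with y hy hyW
  exact ⟨0, hyW, by simpa [hy] using hε⟩

/-- The zero section approximates every element up to its norm. -/
theorem approxAt_norm (hE : IsBanachBundle E) {x : X} (b : E x) :
    ApproxAt ‖b‖ (fun _ => 0) x b := by
  intro ε hε W hW
  have h1 : {e : Tot E | ‖e.val‖ < ε} ∈ 𝓝 (⟨x, b⟩ : Tot E) :=
    (isOpen_lt hE.continuous_norm continuous_const).mem_nhds hε
  -- Openness of the projection: every fibre near `x` contains an element of `W` of norm below `ε`.
  filter_upwards [hE.isOpenMap_proj.image_mem_nhds (Filter.inter_mem hW h1)] with y hy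
  obtain ⟨⟨z, e⟩, ⟨he, he'⟩, rfl⟩ := hy
  exact ⟨e, he, by simpa using he'⟩

theorem ApproxAt.sum (hE : IsBanachBundle E) {ι : Type*} (I : Finset ι) {r : ι → ℝ}
    {s : ι → ∀ x, E x} {x : X} {b : ι → E x} (h : ∀ i ∈ I, ApproxAt (r i) (s i) x (b i)) :
    ApproxAt (∑ i ∈ I, r i) (fun y => ∑ i ∈ I, s i y) x (∑ i ∈ I, b i) := by
  classical
  induction I using Finset.induction_on with
  | empty => simpa using approxAt_zero_of_eventuallyEq hE (s := fun _ => 0) (by simp)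
  | insert i I hi ih =>
    simp only [Finset.sum_insert hi]
    exact (h i (Finset.mem_insert_self i I)).add hE
      (ih fun j hj => h j (Finset.mem_insert_of_mem hj))

/-- Write `s y = e + (s y - e)` with `e` close to `s x`. The remainder has small norm, so it is
close to the zero of the fibre at `x`, and addition is continuous at `(s x, 0)`. -/
theorem ApproxAt.continuousAt (hE : IsBanachBundle E) {s : ∀ x, E x} {x : X}
    (h : ApproxAt 0 s x (s x)) : ContinuousAt (fun y => (⟨y, s y⟩ : Tot E)) x := by
  intro W (hW : W ∈ 𝓝 (⟨x, s x⟩ : Tot E))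
  rw [← add_zero (s x)] at hW
  obtain ⟨U, hU, V, hV, hUV⟩ := hE.exists_nhds_add hW
  obtain ⟨⟨N, ε⟩, ⟨hN, hxN, hε⟩, hNV⟩ := (hE.nhds_zero x).mem_iff.1 hV
  rw [Filter.mem_map]
  filter_upwards [h ε hε U hU, hN.mem_nhds hxN] with y ⟨e, he, hse⟩ hyN
  have := hUV y e (s y - e) he (hNV ⟨hyN, hse⟩)
  simpa using this

theorem approxAt_of_continuousAt {s : ∀ x, E x} {x : X}
    (h : ContinuousAt (fun y => (⟨y, s y⟩ : Tot E)) x) : ApproxAt 0 s x (s x) := by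
  intro ε hε W hW
  filter_upwards [h hW] with y hy
  exact ⟨s y, hy, by simpa using hε⟩

/-- A uniform limit of sections which are more and more continuous is continuous. -/
theorem continuous_of_approxAt (hE : IsBanachBundle E) {s : ∀ x, E x}
    (h : ∀ ε > 0, ∃ t : ∀ x, E x, (∀ x, ApproxAt ε t x (t x)) ∧ ∀ x, ‖s x - t x‖ ≤ ε) :
    Continuous (fun x => (⟨x, s x⟩ : Tot E)) := by
  refine continuous_iff_continuousAt.2 fun x => ApproxAt.continuousAt hE ?_
  intro ε hε
  obtain ⟨t, ht, hst⟩ := h (ε / 4) (by positivity)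
  -- Three errors of at most `ε / 4`: that of `t`, that of the zero section as an approximation of
  -- `s x - t x`, and the uniform distance from `t` to `s`.
  have h1 := ((ht x).add hE (approxAt_norm hE (s x - t x))).of_norm_sub_le (t := s) (c := ε / 4)
    (by simpa using hst)
  rw [add_sub_cancel] at h1
  exact h1 ε (by linarith [hst x])

/-- The norm of a difference is continuous and vanishes at `(b, b)`. The difference appears as `b +
(-1) • b` because the bundle axioms speak of sums and scalar multiples. -/
theorem exists_thin_nhds (hE : IsBanachBundle E) (x : X) (b : E x) {r : ℝ} (hr : 0 < r) :
    ∃ U : Set (Tot E), IsOpen U ∧ (⟨x, b⟩ : Tot E) ∈ U ∧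
      ∀ (y : X) (e f : E y), (⟨y, e⟩ : Tot E) ∈ U → (⟨y, f⟩ : Tot E) ∈ U → ‖e - f‖ < r := by
  have h1 : {e : Tot E | ‖e.val‖ < r} ∈ 𝓝 (⟨x, b + (-1 : ℂ) • b⟩ : Tot E) :=
    (isOpen_lt hE.continuous_norm continuous_const).mem_nhds (by simpa using hr)
  obtain ⟨U, hU, V, hV, hUV⟩ := hE.exists_nhds_add h1
  obtain ⟨N, hN, V', hV', hNV⟩ := hE.exists_nhds_smul hV
  obtain ⟨O, hO, hOo, hxO⟩ := mem_nhds_iff.1 (Filter.inter_mem hU hV')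
  refine ⟨O, hOo, hxO, fun y e f he hf => ?_⟩
  have := hUV y e ((-1 : ℂ) • f) (hO he).1 (hNV y _ f (mem_of_mem_nhds hN) (hO hf).2)
  simpa [sub_eq_add_neg] using this

/-- Through every element there passes a local section which is continuous up to `r`. -/
theorem exists_local_approx (hE : IsBanachBundle E) {x : X} (b : E x) {r : ℝ} (hr : 0 < r) :
    ∃ (V : Set X) (t : ∀ y, E y) (U : Set (Tot E)), IsOpen V ∧ x ∈ V ∧ t x = b ∧
      U ∈ 𝓝 (⟨x, b⟩ : Tot E) ∧ (∀ y ∈ V, ApproxAt r t y (t y)) ∧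
      ∀ y ∈ V, ∀ e : E y, (⟨y, e⟩ : Tot E) ∈ U → ‖t y - e‖ < r := by
  classical
  obtain ⟨U, hU, hxU, hthin⟩ := hE.exists_thin_nhds x b hr
  -- Over the image of the thin set `U` any value inside `U` will do, without continuity, because
  -- two such values differ by less than `r`; only the value `b` at `x` is prescribed.
  have hex : ∀ y, ∃ e : E y, (y ∈ Tot.base '' U → (⟨y, e⟩ : Tot E) ∈ U) ∧
      ∀ h : x = y, e = h ▸ b := by
    intro y
    by_cases h : x = y
    · subst h
      exact ⟨b, fun _ => hxU, fun _ => rfl⟩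
    · by_cases hy : y ∈ Tot.base '' U
      · obtain ⟨⟨z, e⟩, he, rfl⟩ := hy
        exact ⟨e, fun _ => he, fun h' => absurd h' h⟩
      · exact ⟨0, fun h' => absurd h' hy, fun h' => absurd h' h⟩
  choose t ht htx using hex
  refine ⟨Tot.base '' U, t, U, hE.isOpenMap_proj _ hU, ⟨_, hxU, rfl⟩, htx x rfl,
    hU.mem_nhds hxU, fun y hy => ?_, fun y hy e he => hthin y _ _ (ht y hy) he⟩
  intro ε hε W hW
  have := hE.isOpenMap_proj.image_mem_nhds (Filter.inter_mem hW (hU.mem_nhds (ht y hy)))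
  filter_upwards [this] with z hz
  obtain ⟨⟨z, e⟩, ⟨he, heU⟩, rfl⟩ := hz
  exact ⟨e, he, (hthin _ _ _ (ht _ ⟨_, heU, rfl⟩) heU).trans hε⟩

/-- The error is scaled by `|ψ x|`, so the errors of local sections average instead of adding up
under a partition of unity. -/
theorem ApproxAt.smul_of_tsupport_subset (hE : IsBanachBundle E) {r : ℝ} (hr : 0 ≤ r)
    {t : ∀ x, E x} {V : Set X} (ht : ∀ y ∈ V, ApproxAt r t y (t y)) (ψ : C(X, ℝ))
    (hψ : tsupport ψ ⊆ V) (x : X) :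
    ApproxAt (|ψ x| * r) (fun y => (ψ y : ℂ) • t y) x ((ψ x : ℂ) • t x) := by
  by_cases hx : x ∈ tsupport ψ
  · have := (ht x (hψ hx)).smul hE (ψ := fun y => (ψ y : ℂ)) (by fun_prop)
    simpa using this
  · have h0 : ∀ᶠ y in 𝓝 x, ψ y = 0 := notMem_tsupport_iff_eventuallyEq.1 hx
    rw [h0.self_of_nhds]
    refine ApproxAt.mono (r := 0) ?_ (by positivity)
    rw [Complex.ofReal_zero, zero_smul]
    refine approxAt_zero_of_eventuallyEq hE ?_
    filter_upwards [h0] with y hy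
    rw [hy, Complex.ofReal_zero, zero_smul]

/-- Local sections through the values of `s`, continuous up to `r / 2`, are pasted by a partition of
unity. Convexity preserves both the tolerance `r / 2` and the distance to `s`. -/
theorem exists_refinement (hE : IsBanachBundle E) [CompactSpace X] [T2Space X] {r : ℝ} (hr : 0 < r)
    {s : ∀ x, E x} (hs : ∀ x, ApproxAt r s x (s x)) :
    ∃ t : ∀ x, E x, (∀ x, ApproxAt (r / 2) t x (t x)) ∧ ∀ x, ‖t x - s x‖ ≤ 3 * r := by
  choose V t U hV hxV htx hU ht htU using fun x => hE.exists_local_approx (s x) (half_pos hr)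
  have hV' : ∀ x, {y | y ∈ V x ∧ ‖t x y - s y‖ < 3 * r} ∈ 𝓝 x := by
    intro x
    -- Near `x`, `s y` is within `2r` of an element of the thin set, which is within `r / 2` of `t x
    -- y`; hence the bound `3r`.
    filter_upwards [(hV x).mem_nhds (hxV x), hs x (2 * r) (by linarith) (U x) (hU x)]
      with y hy ⟨e, he, hse⟩
    refine ⟨hy, ?_⟩
    calc ‖t x y - s y‖ = ‖(t x y - e) - (s y - e)‖ := by congr 1; abel
      _ ≤ ‖t x y - e‖ + ‖s y - e‖ := norm_sub_le _ _
      _ < 3 * r := by linarith [htU x y hy e he]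
  obtain ⟨F, hF⟩ := isCompact_univ.elim_nhds_subcover
    (fun x => interior {y | y ∈ V x ∧ ‖t x y - s y‖ < 3 * r})
    (fun x _ => interior_mem_nhds.2 (hV' x))
  obtain ⟨ψ, hψ⟩ := PartitionOfUnity.exists_isSubordinate (isClosed_univ (X := X))
    (fun i : F => interior {y | y ∈ V i ∧ ‖t i y - s y‖ < 3 * r}) (fun _ => isOpen_interior)
    (by
      intro x hx
      have := hF.2 hx
      simp only [Set.mem_iUnion] at this ⊢
      obtain ⟨i, hi, h⟩ := this
      exact ⟨⟨i, hi⟩, h⟩)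
  have hsum : ∀ x, ∑ i, ψ i x = 1 := fun x => by
    rw [← finsum_eq_sum_of_fintype]
    exact ψ.sum_eq_one (Set.mem_univ x)
  have hsub : ∀ i, tsupport (ψ i) ⊆ {y | y ∈ V i ∧ ‖t i y - s y‖ < 3 * r} :=
    fun i => (hψ i).trans interior_subset
  refine ⟨fun y => ∑ i, (ψ i y : ℂ) • t i y, fun x => ?_, fun x => ?_⟩
  · have := ApproxAt.sum hE Finset.univ fun (i : F) _ =>
      ApproxAt.smul_of_tsupport_subset hE (half_pos hr).le (ht i) (ψ i)
        (fun y hy => (hsub i hy).1) x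
    refine this.mono ?_
    rw [← Finset.sum_mul]
    simp_rw [abs_of_nonneg (ψ.nonneg _ x)]
    rw [hsum, one_mul]
  · have h1 : ∑ i, (ψ i x : ℂ) • t i x - s x = ∑ i, (ψ i x : ℂ) • (t i x - s x) := by
      simp_rw [smul_sub]
      rw [Finset.sum_sub_distrib, ← Finset.sum_smul]
      norm_cast
      rw [hsum]
      simp
    rw [h1]
    calc ‖∑ i, (ψ i x : ℂ) • (t i x - s x)‖ ≤ ∑ i, ψ i x * (3 * r) := by
          refine norm_sum_le_of_le _ fun i _ => ?_
          rw [norm_smul, Complex.norm_real, Real.norm_of_nonneg (ψ.nonneg i x)]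
          by_cases hx : x ∈ tsupport (ψ i)
          · exact mul_le_mul_of_nonneg_left (hsub i hx).2.le (ψ.nonneg i x)
          · simp [image_eq_zero_of_notMem_tsupport hx]
      _ = 3 * r := by rw [← Finset.sum_mul, hsum, one_mul]

/-- Over a compact Hausdorff space, a section which is continuous up to `r` is close to a continuous
section. -/
theorem exists_continuous_near (hE : IsBanachBundle E) [CompactSpace X] [T2Space X] {r : ℝ}
    (hr : 0 < r) {s : ∀ x, E x} (hs : ∀ x, ApproxAt r s x (s x)) :
    ∃ t ∈ continuousSections hE, ∀ x, ‖t x - s x‖ ≤ 6 * r := by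
  choose! next hnext hdist using fun (n : ℕ) (s : ∀ x, E x)
    (hs : ∀ x, ApproxAt (r / 2 ^ n) s x (s x)) =>
      hE.exists_refinement (r := r / 2 ^ n) (by positivity) hs
  -- Iterating the refinement halves the tolerance each time; the displacements `3r / 2^n` sum to
  -- `6r`.
  let q : ℕ → ∀ x, E x := fun n => Nat.rec s next n
  have hq : ∀ n x, ApproxAt (r / 2 ^ n) (q n) x (q n x) := by
    intro n
    induction n with
    | zero =>
      rw [pow_zero, div_one]
      exact hs
    | succ n ih =>
      intro x
      have := hnext n (q n) ih x
      rwa [div_div, ← pow_succ] at this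
  have hd : ∀ x n, dist (q n x) (q (n + 1) x) ≤ (6 * r) / 2 / 2 ^ n := by
    intro x n
    rw [dist_comm, dist_eq_norm]
    refine (hdist n (q n) (hq n) x).trans (le_of_eq ?_)
    ring
  have hlim : ∀ x, ∃ l, Filter.Tendsto (fun n => q n x) Filter.atTop (𝓝 l) := by
    intro x
    have := hE.complete x
    exact cauchySeq_tendsto_of_complete (cauchySeq_of_le_geometric_two (hd x))
  choose t ht using hlim
  refine ⟨t, ?_, fun x => ?_⟩
  · refine hE.continuous_of_approxAt fun ε hε => ?_
    -- For this `n` both the tolerance `r / 2^n` of `q n` and its distance `6r / 2^n` from the limit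
    -- are at most `ε`.
    obtain ⟨n, hn⟩ := exists_pow_lt_of_lt_one (show 0 < ε / (6 * r) by positivity)
      (show (1 / 2 : ℝ) < 1 by norm_num)
    rw [lt_div_iff₀ (by positivity)] at hn
    have hn' : 6 * r / 2 ^ n ≤ ε := by
      rw [one_div, inv_pow] at hn
      rw [div_eq_mul_inv, mul_comm]
      exact hn.le
    refine ⟨q n, fun x => (hq n x).mono (le_trans ?_ hn'), fun x => ?_⟩
    · gcongr
      linarith
    · rw [← dist_eq_norm, dist_comm]
      exact (dist_le_of_le_geometric_two_of_tendsto (hd x) (ht x) n).trans hn'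
  · rw [← dist_eq_norm, dist_comm]
    exact dist_le_of_le_geometric_two_of_tendsto₀ (hd x) (ht x)

/-- The values of the continuous sections of a Banach bundle over a compact Hausdorff space are
dense in every fibre. -/
theorem exists_section_near (hE : IsBanachBundle E) [CompactSpace X] [T2Space X] {x : X} (b : E x)
    {δ : ℝ} (hδ : 0 < δ) : ∃ t ∈ continuousSections hE, ‖t x - b‖ ≤ δ := by
  obtain ⟨V, t, U, hV, hxV, htx, -, ht, -⟩ :=
    hE.exists_local_approx b (show 0 < δ / 6 by positivity)
  -- A partition of unity on `{x}` with a single member is a bump function equal to `1` at `x`, so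
  -- the cut-off section still has the value `b` there.
  obtain ⟨ρ, hρ⟩ := PartitionOfUnity.exists_isSubordinate (isClosed_singleton (x := x))
    (fun _ : Unit => V) (fun _ => hV) (by simpa using hxV)
  let ψ := ρ ()
  have key : ∀ y, ApproxAt (δ / 6) (fun y => (ψ y : ℂ) • t y) y ((ψ y : ℂ) • t y) := fun y =>
    (ApproxAt.smul_of_tsupport_subset hE (by positivity) ht ψ (hρ ()) y).mono (by
      rw [abs_of_nonneg (ρ.nonneg () y)]
      exact mul_le_of_le_one_left (by positivity) (ρ.le_one () y))
  obtain ⟨w, hw, hwt⟩ := hE.exists_continuous_near (by positivity) key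
  refine ⟨w, hw, ?_⟩
  have h1 := hwt x
  have h2 : ψ x = 1 := by
    simpa [finsum_eq_sum_of_fintype] using ρ.sum_eq_one (Set.mem_singleton x)
  simp only [h2, Complex.ofReal_one, one_smul, htx] at h1
  linarith

end IsBanachBundle

/-! ### Positivity in the fibres over the units -/

open scoped ComplexOrder in
/-- Positive functionals detect nonzero positive elements of a C*-algebra. -/
theorem CStarAlgebra.exists_positive_functional {A : Type*} [CStarAlgebra A] (a : A) (ha : a ≠ 0) :
    ∃ ω : A →ₗ[ℂ] ℂ, (∀ b, 0 ≤ (ω (star b * b)).re) ∧ (∀ b, ω (star b) = starRingEnd ℂ (ω b)) ∧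
      ω (star a * a) ≠ 0 := by
  let _ := CStarAlgebra.spectralOrder A
  have := CStarAlgebra.spectralOrderedRing A
  -- Hahn–Banach separates `-(a* a)` from the closed cone of positive elements.
  have hneg : -(star a * a) ∉ ProperCone.positive ℝ A := by
    rw [ProperCone.mem_positive]
    intro h
    have h0 : star a * a = 0 := le_antisymm (neg_nonneg.1 h) (star_mul_self_nonneg a)
    exact ha (CStarRing.star_mul_self_eq_zero_iff a |>.1 h0)
  obtain ⟨f, hf, hfa⟩ := ProperCone.hyperplane_separation_point _ hneg
  have hpos : ∀ b, 0 ≤ f (star b * b) := fun b => hf _ (by simp [star_mul_self_nonneg])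
  -- The separating functional is only real linear; adding its composite with the star makes its
  -- complexification hermitian.
  let g : Module.Dual ℝ A := f.toLinearMap ∘ₗ
    (LinearMap.id + (starLinearEquiv ℝ (A := A)).toLinearMap)
  have hg : ∀ b, g b = f b + f (star b) := fun b => by simp [g]
  have hre : ∀ b, (g.extendRCLike b : ℂ).re = g b := fun b =>
    Module.Dual.re_extendRCLike_apply (𝕜 := ℂ) g b
  have him : ∀ b, (g.extendRCLike b : ℂ).im = -g (Complex.I • b) := fun b =>
    Module.Dual.im_extendRCLike_apply (𝕜 := ℂ) g b
  refine ⟨g.extendRCLike, fun b => ?_, fun b => ?_, fun h => ?_⟩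
  · rw [hre, hg, star_mul, star_star]
    linarith [hpos b]
  · apply Complex.ext
    · rw [Complex.conj_re, hre, hre, hg, hg, star_star, add_comm]
    · rw [Complex.conj_im, him, him, hg, hg]
      simp only [star_smul, star_star, Complex.star_def, Complex.conj_I, neg_smul, map_neg]
      ring
  · have h1 := congrArg Complex.re h
    rw [hre, hg, star_mul, star_star, Complex.zero_re] at h1
    rw [map_neg] at hfa
    linarith

namespace FellBundle

variable {M : Type u} [TopologicalSpace M]

/-- The fibre of a unital Fell bundle over a unit, as a C*-algebra. -/
def UnitFib (E : FellBundle M) (_ : E.IsUnital) (x : M) : Type u := E.Fib (x, x)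

/-- Norm and addition are those of the fibre, so facts about the C*-algebra transfer to `E.Fib (x,
x)` by definitional unfolding. -/
noncomputable instance (E : FellBundle M) (h : E.IsUnital) (x : M) :
    NormedRing (E.UnitFib h x) :=
  { E.normed (x, x) with
    mul := fun a b => E.mul (x := x) (y := x) (z := x) a b
    one := E.one h x
    left_distrib := fun a b c => E.mul_add a b c
    right_distrib := fun a b c => E.add_mul a b c
    zero_mul := fun a => by
      have := E.sub_mul (0 : E.Fib (x, x)) 0 (show E.Fib (x, x) from a)
      rwa [sub_self, sub_self] at this
    mul_zero := fun a => by
      have := E.mul_sub (show E.Fib (x, x) from a) 0 (0 : E.Fib (x, x))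
      rwa [sub_self, sub_self] at this
    mul_assoc := fun a b c => E.mul_assoc a b c
    one_mul := fun a => (E.one_isIdentity h x a).1
    mul_one := fun a => (E.one_isIdentity h x a).2
    norm_mul_le := fun a b => E.norm_mul_le a b }

noncomputable instance (E : FellBundle M) (h : E.IsUnital) (x : M) :
    Module ℂ (E.UnitFib h x) :=
  (E.space (x, x)).toModule

noncomputable instance (E : FellBundle M) (h : E.IsUnital) (x : M) :
    NormedAlgebra ℂ (E.UnitFib h x) :=
  { Algebra.ofModule (R := ℂ) (A := E.UnitFib h x) (fun t a b => E.smul_mul t a b)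
      (fun t a b => E.mul_smul t a b) with
    norm_smul_le := (E.space (x, x)).norm_smul_le }

noncomputable instance (E : FellBundle M) (h : E.IsUnital) (x : M) :
    StarRing (E.UnitFib h x) where
  star := fun a => E.adj (x := x) (y := x) a
  star_involutive := fun a => E.adj_adj a
  star_mul := fun a b => E.adj_mul a b
  star_add := fun a b => E.adj_add a b

noncomputable instance (E : FellBundle M) (h : E.IsUnital) (x : M) :
    CStarAlgebra (E.UnitFib h x) where
  complete := (E.banach.complete (x, x)).complete
  norm_mul_self_le := fun a => ((E.norm_adj_mul (x := x) (y := x) a).trans (pow_two _)).ge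
  star_smul := fun t a => E.adj_smul t a

/-- A positive hermitian functional on the fibre over a unit. -/
structure PosFunctional (E : FellBundle M) (z : M) where
  toFun : E.Fib (z, z) →ₗ[ℂ] ℂ
  nonneg : ∀ b : E.Fib (z, z), 0 ≤ (toFun (E.mul (E.adj b) b)).re
  hermitian : ∀ b : E.Fib (z, z), toFun (E.adj b) = starRingEnd ℂ (toFun b)

/-- The positivity axiom replaces `a* a`, for `a` between different points, by `b* b` with `b` in
the C*-algebra over `y`. -/
theorem exists_posFunctional (E : FellBundle M) (h : E.IsUnital) {x y : M} (a : E.Fib (x, y))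
    (ha : a ≠ 0) : ∃ ω : E.PosFunctional y, ω.toFun (E.mul (E.adj a) a) ≠ 0 := by
  obtain ⟨b, hb⟩ := E.adj_mul_pos a
  have hb0 : b ≠ 0 := by
    rintro rfl
    refine ha (E.eq_zero_of_adj_mul a (hb.trans ?_))
    exact mul_zero (M₀ := E.UnitFib h y) _
  obtain ⟨ω, h1, h2, h3⟩ :=
    CStarAlgebra.exists_positive_functional (A := E.UnitFib h y) b hb0
  exact ⟨⟨⟨⟨ω, fun a b => ω.map_add a b⟩, fun t a => ω.map_smul t a⟩, h1, h2⟩, hb ▸ h3⟩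

/-- In a C*-algebra `b* b ≤ ‖b‖²`, and a positive element has the form `d* d`. The axiom
`adj_mul_pos` provides `b` with `c* c = b* b`, and the C*-identity gives `‖c‖ = ‖b‖`. -/
theorem exists_norm_sq_sub_eq (E : FellBundle M) (h : E.IsUnital) {x y : M} (c : E.Fib (x, y)) :
    ∃ d : E.Fib (y, y),
      ((‖c‖ ^ 2 : ℝ) : ℂ) • E.one h y - E.mul (E.adj c) c = E.mul (E.adj d) d := by
  let _ := CStarAlgebra.spectralOrder (E.UnitFib h y)
  have := CStarAlgebra.spectralOrderedRing (E.UnitFib h y)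
  obtain ⟨b, hb⟩ := E.adj_mul_pos c
  have h1 : ∀ a : E.UnitFib h y, star a * a ≤ algebraMap ℝ (E.UnitFib h y) (‖a‖ ^ 2) :=
    fun _ => CStarAlgebra.star_mul_le_algebraMap_norm_sq
  obtain ⟨d, hd⟩ := CStarAlgebra.nonneg_iff_eq_star_mul_self.1 (sub_nonneg.2 (h1 b))
  refine ⟨d, ?_⟩
  have hn : ‖c‖ ^ 2 = ‖b‖ ^ 2 := by rw [← E.norm_adj_mul, hb, E.norm_adj_mul]
  rw [hb, hn]
  exact hd

namespace PosFunctional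

variable {E : FellBundle M}

theorem nonneg' {z : M} (ω : E.PosFunctional z) {x : M} (a : E.Fib (x, z)) :
    0 ≤ (ω.toFun (E.mul (E.adj a) a)).re := by
  obtain ⟨b, hb⟩ := E.adj_mul_pos a
  rw [hb]
  exact ω.nonneg b

/-- With `d* d = ‖c‖² - c* c`, the difference of the two sides is `ω((da)* (da)) ≥ 0`. This makes
left multiplication bounded on the GNS spaces. -/
theorem re_mul_le (h : E.IsUnital) {z : M} (ω : E.PosFunctional z) {x y : M} (c : E.Fib (x, y))
    (a : E.Fib (y, z)) :
    (ω.toFun (E.mul (E.adj (E.mul c a)) (E.mul c a))).re ≤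
      ‖c‖ ^ 2 * (ω.toFun (E.mul (E.adj a) a)).re := by
  obtain ⟨d, hd⟩ := E.exists_norm_sq_sub_eq h c
  have h1 := ω.nonneg' (E.mul d a)
  have h2 : E.mul (E.adj (E.mul d a)) (E.mul d a) =
      ((‖c‖ ^ 2 : ℝ) : ℂ) • E.mul (E.adj a) a - E.mul (E.adj (E.mul c a)) (E.mul c a) := by
    rw [E.adj_mul, E.adj_mul, E.mul_assoc, ← E.mul_assoc _ d, ← hd, E.sub_mul, E.mul_sub,
      E.smul_mul, E.mul_smul, E.identity_mul (E.one_isIdentity h y), E.mul_assoc _ _ (E.mul c a),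
      ← E.mul_assoc (E.adj c)]
  rw [h2, map_sub, map_smul, Complex.sub_re, smul_eq_mul, Complex.re_ofReal_mul] at h1
  linarith

end PosFunctional

end FellBundle

/-! ### Representations of C*-categories on families of Hilbert spaces -/

section Monomial

set_option linter.unusedSectionVars false

variable {ι κ : Type*} {K : ι → Type*} {L : κ → Type*} [∀ i, NormedAddCommGroup (K i)]
  [∀ i, InnerProductSpace ℂ (K i)] [∀ k, NormedAddCommGroup (L k)]
  [∀ k, InnerProductSpace ℂ (L k)]

theorem lp.summable_norm_sq (ξ : lp K 2) : Summable fun i => ‖ξ i‖ ^ 2 := by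
  have := (lp.memℓp ξ).summable (by norm_num)
  simpa using this

theorem lp.norm_sq_eq_tsum (ξ : lp K 2) : ‖ξ‖ ^ 2 = ∑' i, ‖ξ i‖ ^ 2 := by
  have := lp.norm_rpow_eq_tsum (p := 2) (by norm_num) ξ
  simpa using this

/-- The operator `(ξ_k) ↦ (b_i ξ_{τ i})` between Hilbert sums. -/
noncomputable def lp.monomial (τ : ι ≃ κ) (b : ∀ i, L (τ i) →L[ℂ] K i) (C : ℝ)
    (hb : ∀ i, ‖b i‖ ≤ C) : lp L 2 →L[ℂ] lp K 2 :=
  have hle : ∀ (ξ : lp L 2) i, ‖b i (ξ (τ i))‖ ^ 2 ≤ C ^ 2 * ‖ξ (τ i)‖ ^ 2 := fun ξ i => by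
    rw [← mul_pow]
    exact pow_le_pow_left₀ (norm_nonneg _) ((b i).le_of_opNorm_le (hb i) _) 2
  have hsum : ∀ ξ : lp L 2, Summable fun i => C ^ 2 * ‖ξ (τ i)‖ ^ 2 := fun ξ =>
    ((lp.summable_norm_sq ξ).comp_injective τ.injective).mul_left _
  LinearMap.mkContinuous
    { toFun := fun ξ => ⟨fun i => b i (ξ (τ i)), memℓp_gen (by
        simpa using (hsum ξ).of_nonneg_of_le (fun i => by positivity) (hle ξ))⟩
      map_add' := fun ξ η => lp.ext (funext fun i => map_add (b i) _ _)
      map_smul' := fun t ξ => lp.ext (funext fun i => map_smul (b i) _ _) } |C| (fun ξ => by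
        refine (sq_le_sq₀ (norm_nonneg _) (by positivity)).1 ?_
        rw [mul_pow, sq_abs, lp.norm_sq_eq_tsum, lp.norm_sq_eq_tsum, ← τ.tsum_eq, ← tsum_mul_left]
        exact ((hsum ξ).of_nonneg_of_le (fun i => by positivity) (hle ξ)).tsum_le_tsum (hle ξ)
          (hsum ξ))

@[simp]
theorem lp.monomial_apply (τ : ι ≃ κ) (b : ∀ i, L (τ i) →L[ℂ] K i) (C : ℝ)
    (hb : ∀ i, ‖b i‖ ≤ C) (ξ : lp L 2) (i : ι) :
    lp.monomial τ b C hb ξ i = b i (ξ (τ i)) := rfl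

theorem lp.norm_monomial_le (τ : ι ≃ κ) (b : ∀ i, L (τ i) →L[ℂ] K i) (C : ℝ)
    (hb : ∀ i, ‖b i‖ ≤ C) : ‖lp.monomial τ b C hb‖ ≤ |C| :=
  ContinuousLinearMap.opNorm_le_bound _ (abs_nonneg C) fun ξ => by
    refine (sq_le_sq₀ (norm_nonneg _) (by positivity)).1 ?_
    have hle : ∀ i, ‖b i (ξ (τ i))‖ ^ 2 ≤ C ^ 2 * ‖ξ (τ i)‖ ^ 2 := fun i => by
      rw [← mul_pow]
      exact pow_le_pow_left₀ (norm_nonneg _) ((b i).le_of_opNorm_le (hb i) _) 2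
    have hsum : Summable fun i => C ^ 2 * ‖ξ (τ i)‖ ^ 2 :=
      ((lp.summable_norm_sq ξ).comp_injective τ.injective).mul_left _
    rw [mul_pow, sq_abs, lp.norm_sq_eq_tsum, lp.norm_sq_eq_tsum, ← τ.tsum_eq, ← tsum_mul_left]
    exact (hsum.of_nonneg_of_le (fun i => by positivity) hle).tsum_le_tsum hle hsum

/-- The diagonal operator `(ξ_i) ↦ (b_i ξ_i)` between Hilbert sums. -/
noncomputable def lp.diagonal {L : ι → Type*} [∀ k, NormedAddCommGroup (L k)]
    [∀ k, InnerProductSpace ℂ (L k)] (b : ∀ i, L i →L[ℂ] K i) (C : ℝ) (hb : ∀ i, ‖b i‖ ≤ C) :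
    lp L 2 →L[ℂ] lp K 2 :=
  lp.monomial (Equiv.refl ι) b C hb

@[simp]
theorem lp.diagonal_apply {L : ι → Type*} [∀ k, NormedAddCommGroup (L k)]
    [∀ k, InnerProductSpace ℂ (L k)] (b : ∀ i, L i →L[ℂ] K i) (C : ℝ) (hb : ∀ i, ‖b i‖ ≤ C)
    (ξ : lp L 2) (i : ι) : lp.diagonal b C hb ξ i = b i (ξ i) := rfl

end Monomial

/-! ### The GNS construction for positive functionals on unit fibres -/

namespace FellBundle

variable {M : Type u} [TopologicalSpace M] {E : FellBundle M}

/-- The fibres `E_{(x, z)}` with the semi-inner product given by a positive functional at `z`. -/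
def PreFib (i : Σ z, E.PosFunctional z) (x : M) : Type u := E.Fib (x, i.1)

noncomputable instance (i : Σ z, E.PosFunctional z) (x : M) : AddCommGroup (PreFib i x) :=
  inferInstanceAs (AddCommGroup (E.Fib (x, i.1)))

noncomputable instance (i : Σ z, E.PosFunctional z) (x : M) : Module ℂ (PreFib i x) :=
  inferInstanceAs (Module ℂ (E.Fib (x, i.1)))

/-- The identification of a fibre with the associated semi-inner product space. -/
noncomputable def toPre (i : Σ z, E.PosFunctional z) (x : M) : E.Fib (x, i.1) ≃ₗ[ℂ] PreFib i x :=
  LinearEquiv.refl ℂ _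

/-- The form `ω(a* b)` may be degenerate; its null vectors disappear in the Hausdorff completion. -/
noncomputable abbrev preFibCore (i : Σ z, E.PosFunctional z) (x : M) :
    PreInnerProductSpace.Core ℂ (PreFib i x) where
  inner a b := i.2.toFun (E.mul (E.adj ((toPre i x).symm a)) ((toPre i x).symm b))
  conj_inner_symm a b := by rw [← i.2.hermitian, E.adj_mul, E.adj_adj]
  re_inner_nonneg a := i.2.nonneg' _
  add_left a b c := by rw [map_add, E.adj_add, E.add_mul, map_add]
  smul_left a b t := by rw [map_smul, E.adj_smul, E.smul_mul, map_smul, smul_eq_mul]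

noncomputable instance (i : Σ z, E.PosFunctional z) (x : M) : SeminormedAddCommGroup (PreFib i x) :=
  InnerProductSpace.Core.toSeminormedAddCommGroup (c := preFibCore i x)

noncomputable instance (i : Σ z, E.PosFunctional z) (x : M) : InnerProductSpace ℂ (PreFib i x) :=
  InnerProductSpace.ofCore (preFibCore i x)

theorem inner_toPre (i : Σ z, E.PosFunctional z) (x : M) (a b : E.Fib (x, i.1)) :
    inner ℂ (toPre i x a) (toPre i x b) = i.2.toFun (E.mul (E.adj a) b) := rfl

theorem norm_toPre_sq (i : Σ z, E.PosFunctional z) (x : M) (a : E.Fib (x, i.1)) :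
    ‖toPre i x a‖ ^ 2 = (i.2.toFun (E.mul (E.adj a) a)).re := by
  rw [← inner_toPre, ← inner_self_eq_norm_sq (𝕜 := ℂ)]
  rfl

/-- Left multiplication by an element of a fibre. -/
noncomputable def leftMul (h : E.IsUnital) (i : Σ z, E.PosFunctional z) {x y : M}
    (c : E.Fib (x, y)) : PreFib i y →L[ℂ] PreFib i x :=
  LinearMap.mkContinuous
    { toFun := fun a => toPre i x (E.mul c ((toPre i y).symm a))
      map_add' := fun a b => by rw [map_add, E.mul_add, map_add]
      map_smul' := fun t a => by rw [map_smul, E.mul_smul, map_smul, RingHom.id_apply] } ‖c‖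
    (fun a => by
      refine (sq_le_sq₀ (norm_nonneg _) (by positivity)).1 ?_
      obtain ⟨a, rfl⟩ := (toPre i y).surjective a
      rw [mul_pow, norm_toPre_sq]
      simp only [LinearMap.coe_mk, AddHom.coe_mk, norm_toPre_sq, LinearEquiv.symm_apply_apply]
      exact i.2.re_mul_le h c a)

theorem leftMul_toPre (h : E.IsUnital) (i : Σ z, E.PosFunctional z) {x y : M}
    (c : E.Fib (x, y)) (a : E.Fib (y, i.1)) :
    leftMul h i c (toPre i y a) = toPre i x (E.mul c a) := rfl

theorem norm_leftMul_le (h : E.IsUnital) (i : Σ z, E.PosFunctional z) {x y : M}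
    (c : E.Fib (x, y)) : ‖(leftMul h i c).completion‖ ≤ ‖c‖ := by
  refine ContinuousLinearMap.opNorm_le_bound _ (norm_nonneg _) fun ξ => ?_
  induction ξ using UniformSpace.Completion.induction_on with
  | hp => exact isClosed_le (by fun_prop) (by fun_prop)
  | ih a =>
    rw [ContinuousLinearMap.completion_apply_coe, UniformSpace.Completion.norm_coe,
      UniformSpace.Completion.norm_coe]
    exact (leftMul h i c).le_of_opNorm_le (LinearMap.mkContinuous_norm_le _ (norm_nonneg _) _) a


theorem completion_leftMul_add (h : E.IsUnital) (i : Σ z, E.PosFunctional z) {x y : M}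
    (c d : E.Fib (x, y)) (v : UniformSpace.Completion (PreFib i y)) :
    (leftMul h i (c + d)).completion v =
      (leftMul h i c).completion v + (leftMul h i d).completion v := by
  induction v using UniformSpace.Completion.induction_on with
  | hp => exact isClosed_eq (by fun_prop) (by fun_prop)
  | ih a =>
    obtain ⟨a, rfl⟩ := (toPre i y).surjective a
    simp only [ContinuousLinearMap.completion_apply_coe, leftMul_toPre, E.add_mul, map_add,
      UniformSpace.Completion.coe_add]

theorem completion_leftMul_smul (h : E.IsUnital) (i : Σ z, E.PosFunctional z) {x y : M} (t : ℂ)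
    (c : E.Fib (x, y)) (v : UniformSpace.Completion (PreFib i y)) :
    (leftMul h i (t • c)).completion v = t • (leftMul h i c).completion v := by
  induction v using UniformSpace.Completion.induction_on with
  | hp =>
    exact isClosed_eq (leftMul h i (t • c)).completion.continuous
      ((leftMul h i c).completion.continuous.const_smul t)
  | ih a =>
    obtain ⟨a, rfl⟩ := (toPre i y).surjective a
    simp only [ContinuousLinearMap.completion_apply_coe, leftMul_toPre, E.smul_mul, map_smul,
      UniformSpace.Completion.coe_smul]

theorem completion_leftMul_mul (h : E.IsUnital) (i : Σ z, E.PosFunctional z) {x y z : M}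
    (c : E.Fib (x, y)) (d : E.Fib (y, z)) (v : UniformSpace.Completion (PreFib i z)) :
    (leftMul h i (E.mul c d)).completion v =
      (leftMul h i c).completion ((leftMul h i d).completion v) := by
  induction v using UniformSpace.Completion.induction_on with
  | hp => exact isClosed_eq (by fun_prop) (by fun_prop)
  | ih a =>
    obtain ⟨a, rfl⟩ := (toPre i z).surjective a
    simp only [ContinuousLinearMap.completion_apply_coe, leftMul_toPre, E.mul_assoc]

theorem inner_completion_leftMul_adj (h : E.IsUnital) (i : Σ z, E.PosFunctional z) {x y : M}
    (c : E.Fib (x, y)) (v : UniformSpace.Completion (PreFib i x))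
    (w : UniformSpace.Completion (PreFib i y)) :
    inner ℂ ((leftMul h i (E.adj c)).completion v) w =
      inner ℂ v ((leftMul h i c).completion w) := by
  induction v, w using UniformSpace.Completion.induction_on₂ with
  | hp => exact isClosed_eq (by fun_prop) (by fun_prop)
  | ih a b =>
    obtain ⟨a, rfl⟩ := (toPre i x).surjective a
    obtain ⟨b, rfl⟩ := (toPre i y).surjective b
    simp only [ContinuousLinearMap.completion_apply_coe, leftMul_toPre,
      UniformSpace.Completion.inner_coe, inner_toPre, E.adj_mul, E.adj_adj, E.mul_assoc]

/-- A faithful representation of the C*-category of a Fell bundle on a family of Hilbert spaces. -/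
structure HilbertRep (E : FellBundle M) where
  K : M → Type u
  [normed : ∀ x, NormedAddCommGroup (K x)]
  [inner : ∀ x, InnerProductSpace ℂ (K x)]
  [complete : ∀ x, CompleteSpace (K x)]
  π : ∀ {x y : M}, E.Fib (x, y) →ₗ[ℂ] (K y →L[ℂ] K x)
  map_mul : ∀ {x y z : M} (a : E.Fib (x, y)) (b : E.Fib (y, z)), π (E.mul a b) = (π a).comp (π b)
  map_adj : ∀ {x y : M} (a : E.Fib (x, y)), π (E.adj a) = (π a).adjoint
  norm_le : ∀ {x y : M} (a : E.Fib (x, y)), ‖π a‖ ≤ ‖a‖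
  eq_zero : ∀ {x y : M} (a : E.Fib (x, y)), π a = 0 → a = 0

attribute [instance] HilbertRep.normed HilbertRep.inner HilbertRep.complete

/-- The universal representation, on the Hilbert sums of the completions of the fibres with respect
to all positive functionals. -/
noncomputable def universalRep (h : E.IsUnital) : E.HilbertRep where
  K := fun x => lp (fun i : Σ z, E.PosFunctional z => UniformSpace.Completion (PreFib i x)) 2
  π := fun {x y} =>
    { toFun := fun c => lp.diagonal (fun i => (leftMul h i c).completion) ‖c‖
        (fun i => norm_leftMul_le h i c)
      map_add' := fun c d => ContinuousLinearMap.ext fun ξ => lp.ext (funext fun i =>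
        completion_leftMul_add h i c d (ξ i))
      map_smul' := fun t c => ContinuousLinearMap.ext fun ξ => lp.ext (funext fun i =>
        completion_leftMul_smul h i t c (ξ i)) }
  map_mul := fun c d => ContinuousLinearMap.ext fun ξ => lp.ext (funext fun i =>
    completion_leftMul_mul h i c d (ξ i))
  map_adj := fun {x y} c => by
    refine (ContinuousLinearMap.eq_adjoint_iff _ _).2 fun ξ η => ?_
    rw [lp.inner_eq_tsum, lp.inner_eq_tsum]
    exact tsum_congr fun i => inner_completion_leftMul_adj h i c (ξ i) (η i)
  norm_le := fun c => (lp.norm_monomial_le _ _ _ _).trans (abs_of_nonneg (norm_nonneg c)).le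
  eq_zero := fun {x y} c hc => by
    classical
    by_contra h0
    obtain ⟨ω, hω⟩ := E.exists_posFunctional h c h0
    let i : Σ z, E.PosFunctional z := ⟨y, ω⟩
    -- The cyclic vector: `c` maps the class of `1_y` to the class of `c`, whose squared norm `ω(c*
    -- c)` is nonzero.
    let v : UniformSpace.Completion (PreFib i y) := (toPre i y (E.one h y) : PreFib i y)
    have h2 : (leftMul h i c).completion v = 0 := by
      have h1 : lp.diagonal (fun i => (leftMul h i c).completion) ‖c‖
        (fun i => norm_leftMul_le h i c) = 0 := hc
      have h3 := lp.diagonal_apply (fun i => (leftMul h i c).completion) ‖c‖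
        (fun i => norm_leftMul_le h i c)
        (lp.single (E := fun i => UniformSpace.Completion (PreFib i y)) 2 i v) i
      rw [h1, lp.single_apply_self] at h3
      exact h3.symm
    rw [ContinuousLinearMap.completion_apply_coe, leftMul_toPre,
      E.mul_identity (E.one_isIdentity h y), ← norm_eq_zero, UniformSpace.Completion.norm_coe] at h2
    have h3 := inner_self_eq_norm_sq_to_K (𝕜 := ℂ) (toPre i x c)
    rw [h2, inner_toPre] at h3
    exact hω (by simpa using h3)

end FellBundle

/-! ### Integral operators with kernels in a Fell bundle -/

/-- The squares are the diagonal terms of the summable family `s x * s y`. -/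
theorem summable_sq_of_nonneg {M : Type*} {s : M → ℝ} (hs0 : ∀ x, 0 ≤ s x) (hs : Summable s) :
    Summable fun y => s y ^ 2 := by
  simp_rw [pow_two]
  exact (hs.mul_of_nonneg hs hs0 hs0).comp_injective (i := fun y : M => (y, y))
    (fun a b h => congrArg Prod.fst h)

namespace FellBundle.HilbertRep

variable {M : Type u} [TopologicalSpace M] {E : FellBundle M} (R : E.HilbertRep)

/-- The Hilbert sum of the spaces of a representation. -/
abbrev Total : Type u := lp R.K 2

open Classical in
/-- An element of the fibre over `(x, y)` as an operator on the Hilbert sum. -/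
noncomputable def elem {x y : M} : E.Fib (x, y) →L[ℂ] (R.Total →L[ℂ] R.Total) :=
  LinearMap.mkContinuous
    { toFun := fun c => (lp.singleContinuousLinearMap ℂ R.K 2 x).comp
        ((R.π c).comp (lp.evalCLM ℂ R.K 2 y))
      map_add' := fun c d => by rw [map_add, ContinuousLinearMap.add_comp,
        ContinuousLinearMap.comp_add]
      map_smul' := fun t c => by rw [map_smul, ContinuousLinearMap.smul_comp,
        ContinuousLinearMap.comp_smul, RingHom.id_apply] } 1 (fun c => by
    refine ContinuousLinearMap.opNorm_le_bound _ (by positivity) fun ξ => ?_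
    change ‖lp.single 2 x (R.π c (ξ y))‖ ≤ _
    rw [lp.norm_single (by norm_num), one_mul]
    exact ((R.π c).le_of_opNorm_le (R.norm_le c) _).trans
      (mul_le_mul_of_nonneg_left (lp.norm_apply_le_norm (by norm_num) ξ y) (norm_nonneg c)))

open Classical in
theorem elem_apply {x y : M} (c : E.Fib (x, y)) (ξ : R.Total) :
    R.elem c ξ = lp.single 2 x (R.π c (ξ y)) := rfl

theorem norm_elem_le {x y : M} (c : E.Fib (x, y)) : ‖R.elem c‖ ≤ ‖c‖ := by
  simpa using (R.elem (x := x) (y := y)).le_of_opNorm_le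
    (LinearMap.mkContinuous_norm_le _ zero_le_one _) c

theorem elem_mul {x y z : M} (c : E.Fib (x, y)) (d : E.Fib (y, z)) :
    R.elem c * R.elem d = R.elem (E.mul c d) := by
  classical
  ext1 ξ
  rw [_root_.mul_apply_eq_comp, elem_apply, elem_apply, elem_apply, lp.single_apply_self,
    R.map_mul]
  rfl

theorem elem_mul_of_ne {x y y' z : M} (c : E.Fib (x, y)) (d : E.Fib (y', z)) (h : y ≠ y') :
    R.elem c * R.elem d = 0 := by
  classical
  ext1 ξ
  rw [_root_.mul_apply_eq_comp, elem_apply, elem_apply, lp.single_apply_ne _ _ _ h, map_zero,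
    lp.single_zero]
  rfl

theorem star_elem {x y : M} (c : E.Fib (x, y)) : star (R.elem c) = R.elem (E.adj c) := by
  classical
  rw [ContinuousLinearMap.star_eq_adjoint]
  refine ((ContinuousLinearMap.eq_adjoint_iff _ _).2 fun ξ η => ?_).symm
  rw [elem_apply, elem_apply, lp.inner_single_left, lp.inner_single_right, R.map_adj,
    ContinuousLinearMap.adjoint_inner_left]

theorem eq_zero_of_elem {x y : M} (c : E.Fib (x, y)) (h : R.elem c = 0) : c = 0 := by
  classical
  refine R.eq_zero c (ContinuousLinearMap.ext fun v => ?_)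
  have h1 := congrArg (fun T : R.Total →L[ℂ] R.Total => T (lp.single 2 y v) x) h
  simp only [elem_apply, lp.single_apply_self] at h1
  exact h1

/-- The operator with kernel `f`, for the measure `∑ s(x)² δ_x`. -/
noncomputable def kernelOp (s : M → ℝ) (f : ∀ g, E.Fib g) : R.Total →L[ℂ] R.Total :=
  ∑' p : M × M, ((s p.1 * s p.2 : ℝ) : ℂ) • R.elem (x := p.1) (y := p.2) (f p)

variable {s : M → ℝ} (hs0 : ∀ x, 0 ≤ s x) (hs : Summable s)

include hs0 hs

/-- Summability of `s` itself, not only of its square, makes the matrix series converge absolutely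
in operator norm. -/
theorem summable_kernelOp {f : ∀ g, E.Fib g} {C : ℝ} (hf : ∀ g, ‖f g‖ ≤ C) :
    Summable fun p : M × M => ((s p.1 * s p.2 : ℝ) : ℂ) • R.elem (x := p.1) (y := p.2) (f p) := by
  refine Summable.of_norm_bounded ((hs.mul_of_nonneg hs hs0 hs0).mul_right C) fun p => ?_
  rw [norm_smul, Complex.norm_real, Real.norm_of_nonneg (mul_nonneg (hs0 _) (hs0 _))]
  exact mul_le_mul_of_nonneg_left ((R.norm_elem_le _).trans (hf p)) (mul_nonneg (hs0 _) (hs0 _))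

theorem kernelOp_add {f g : ∀ g, E.Fib g} {C D : ℝ} (hf : ∀ p, ‖f p‖ ≤ C) (hg : ∀ p, ‖g p‖ ≤ D) :
    R.kernelOp s (f + g) = R.kernelOp s f + R.kernelOp s g := by
  rw [kernelOp, kernelOp, kernelOp,
    ← (R.summable_kernelOp hs0 hs hf).tsum_add (R.summable_kernelOp hs0 hs hg)]
  refine tsum_congr fun p => ?_
  rw [← smul_add, ← map_add]
  rfl

omit hs0 hs in
theorem kernelOp_smul (t : ℂ) (f : ∀ g, E.Fib g) :
    R.kernelOp s (t • f) = t • R.kernelOp s f := by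
  rw [kernelOp, kernelOp, ← tsum_const_smul'']
  refine tsum_congr fun p => ?_
  rw [smul_comm t]
  exact congrArg _ (map_smul R.elem t _)

omit hs0 hs in
theorem star_kernelOp {f h : ∀ g, E.Fib g} (hh : ∀ x y, h (x, y) = E.adj (f (y, x))) :
    R.kernelOp s h = star (R.kernelOp s f) := by
  rw [kernelOp, kernelOp, tsum_star, ← (Equiv.prodComm M M).tsum_eq]
  refine tsum_congr fun p => ?_
  obtain ⟨x, y⟩ := p
  rw [star_smul, star_elem, Complex.star_def, Complex.conj_ofReal]
  change ((s y * s x : ℝ) : ℂ) • R.elem (h (y, x)) = ((s x * s y : ℝ) : ℂ) • R.elem _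
  rw [mul_comm, hh]

theorem kernelOp_mul_elem {f : ∀ g, E.Fib g} {C : ℝ} (hf : ∀ g, ‖f g‖ ≤ C) {y z : M}
    (d : E.Fib (y, z)) :
    R.kernelOp s f * R.elem d =
      ∑' x, ((s x * s y : ℝ) : ℂ) • R.elem (E.mul (f (x, y)) d) := by
  have h1 := (R.summable_kernelOp hs0 hs hf).mul_right (R.elem d)
  rw [kernelOp, ← (R.summable_kernelOp hs0 hs hf).tsum_mul_right, h1.tsum_prod]
  refine tsum_congr fun x => ?_
  rw [tsum_eq_single y]
  · rw [smul_mul_assoc, elem_mul]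
  · intro y' hy
    rw [smul_mul_assoc, elem_mul_of_ne _ _ _ hy, smul_zero]

theorem summable_conv {f g : ∀ g, E.Fib g} {C D : ℝ} (hf : ∀ p, ‖f p‖ ≤ C) (hg : ∀ p, ‖g p‖ ≤ D)
    (x z : M) :
    Summable fun y => ((s y ^ 2 : ℝ) : ℂ) • E.mul (f (x, y)) (g (y, z)) := by
  have := E.banach.complete (x, z)
  have h2 := summable_sq_of_nonneg hs0 hs
  refine Summable.of_norm_bounded (h2.mul_right (C * D)) fun y => ?_
  rw [norm_smul, Complex.norm_real, Real.norm_of_nonneg (sq_nonneg _)]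
  refine mul_le_mul_of_nonneg_left ((E.norm_mul_le _ _).trans ?_) (sq_nonneg _)
  exact mul_le_mul (hf _) (hg _) (norm_nonneg _) ((norm_nonneg _).trans (hf (x, y)))

/-- In the matrix product the middle index receives a factor `s(y)` from each side, which is exactly
the mass `s(y)²` in the convolution. Both sides sum one absolutely convergent family over triples.
-/
theorem kernelOp_mul {f g h : ∀ g, E.Fib g} {C D : ℝ} (hf : ∀ p, ‖f p‖ ≤ C) (hg : ∀ p, ‖g p‖ ≤ D)
    (hh : ∀ x z, h (x, z) = ∑' y, ((s y ^ 2 : ℝ) : ℂ) • E.mul (f (x, y)) (g (y, z))) :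
    R.kernelOp s h = R.kernelOp s f * R.kernelOp s g := by
  let F : (M × M) × M → (R.Total →L[ℂ] R.Total) := fun q =>
    ((s q.1.1 * s q.1.2 * s q.2 ^ 2 : ℝ) : ℂ) •
      R.elem (E.mul (f (q.1.1, q.2)) (g (q.2, q.1.2)))
  have h2 := summable_sq_of_nonneg hs0 hs
  have hF : Summable F := by
    have h3 := (hs.mul_of_nonneg hs hs0 hs0).mul_of_nonneg h2
      (fun p => mul_nonneg (hs0 p.1) (hs0 p.2)) (fun y => sq_nonneg (s y))
    refine Summable.of_norm_bounded (h3.mul_right (C * D)) fun q => ?_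
    have hq : 0 ≤ s q.1.1 * s q.1.2 * s q.2 ^ 2 :=
      mul_nonneg (mul_nonneg (hs0 _) (hs0 _)) (sq_nonneg _)
    rw [norm_smul, Complex.norm_real, Real.norm_of_nonneg hq]
    refine mul_le_mul_of_nonneg_left ((R.norm_elem_le _).trans ((E.norm_mul_le _ _).trans ?_)) hq
    exact mul_le_mul (hf _) (hg _) (norm_nonneg _) ((norm_nonneg _).trans (hf (q.1.1, q.2)))
  have hl : R.kernelOp s h = ∑' q, F q := by
    rw [hF.tsum_prod, kernelOp]
    refine tsum_congr fun p => ?_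
    obtain ⟨x, z⟩ := p
    rw [hh, ContinuousLinearMap.map_tsum _ (summable_conv hs0 hs hf hg x z), ← tsum_const_smul'']
    refine tsum_congr fun y => ?_
    rw [map_smul, smul_smul, ← Complex.ofReal_mul]
  -- The exchange `((y, z), x) ↔ ((x, z), y)` of the outer left index with the middle one.
  let e : (M × M) × M ≃ (M × M) × M :=
    { toFun := fun q => ((q.2, q.1.2), q.1.1)
      invFun := fun q => ((q.2, q.1.2), q.1.1)
      left_inv := fun _ => rfl
      right_inv := fun _ => rfl }
  have hr : R.kernelOp s f * R.kernelOp s g = ∑' q, F (e q) := by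
    have h4 := R.summable_kernelOp hs0 hs hg
    have h5 : Summable fun q => F (e q) := e.summable_iff.2 hF
    rw [h5.tsum_prod]
    conv_lhs => rw [kernelOp.eq_def R s g]
    rw [← h4.tsum_mul_left]
    refine tsum_congr fun p => ?_
    obtain ⟨y, z⟩ := p
    rw [mul_smul_comm, R.kernelOp_mul_elem hs0 hs hf, ← tsum_const_smul'']
    refine tsum_congr fun x => ?_
    rw [smul_smul, ← Complex.ofReal_mul]
    change _ = ((s x * s z * s y ^ 2 : ℝ) : ℂ) • _
    congr 2
    ring
  rw [hl, hr, e.tsum_eq]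

/-- Multiplying by `1_x` on the left and `1_y` on the right isolates the entry `s(x) s(y) f(x,y)`.
-/
theorem eq_zero_of_kernelOp (hE : E.IsUnital) {f : ∀ g, E.Fib g} {C : ℝ} (hf : ∀ g, ‖f g‖ ≤ C)
    (h : R.kernelOp s f = 0) {x y : M} (hx : s x ≠ 0) (hy : s y ≠ 0) : f (x, y) = 0 := by
  have h1 := R.kernelOp_mul_elem hs0 hs hf (E.one hE y)
  rw [h, zero_mul] at h1
  have hsum : Summable fun x => ((s x * s y : ℝ) : ℂ) • R.elem (E.mul (f (x, y)) (E.one hE y)) := by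
    refine Summable.of_norm_bounded ((hs.mul_right (s y)).mul_right C) fun x => ?_
    rw [norm_smul, Complex.norm_real, Real.norm_of_nonneg (mul_nonneg (hs0 _) (hs0 _)),
      E.mul_identity (E.one_isIdentity hE y)]
    exact mul_le_mul_of_nonneg_left ((R.norm_elem_le _).trans (hf _)) (mul_nonneg (hs0 _) (hs0 _))
  have h2 := congrArg (R.elem (E.one hE x) * ·) h1
  simp only [mul_zero] at h2
  rw [← hsum.tsum_mul_left, tsum_eq_single x, mul_smul_comm, elem_mul,
    E.mul_identity (E.one_isIdentity hE y), E.identity_mul (E.one_isIdentity hE x)] at h2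
  · refine R.eq_zero_of_elem _ ((smul_eq_zero.1 h2.symm).resolve_left ?_)
    exact_mod_cast mul_ne_zero hx hy
  · intro x' hx'
    rw [mul_smul_comm, elem_mul_of_ne _ _ _ (Ne.symm hx'), smul_zero]

/-- Reindexing along `φ` turns the weight `s(x)` into `s(φ x)`; here the invariance of the measure
is indispensable to the argument. -/
theorem mul_kernelOp (φ : M ≃ M) (hφ : ∀ x, s (φ x) = s x) {b : ∀ x, E.Fib (x, φ x)}
    {B : R.Total →L[ℂ] R.Total}
    (hB : ∀ {x y : M} (c : E.Fib (φ x, y)), B * R.elem c = R.elem (E.mul (b x) c))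
    {f h : ∀ g, E.Fib g} {C : ℝ} (hf : ∀ g, ‖f g‖ ≤ C)
    (hh : ∀ x y, h (x, y) = E.mul (b x) (f (φ x, y))) :
    R.kernelOp s h = B * R.kernelOp s f := by
  conv_rhs => rw [kernelOp]
  rw [← (R.summable_kernelOp hs0 hs hf).tsum_mul_left,
    ← (Equiv.prodCongr φ (Equiv.refl M)).tsum_eq, kernelOp]
  refine tsum_congr fun p => ?_
  obtain ⟨x, y⟩ := p
  rw [mul_smul_comm]
  change _ = ((s (φ x) * s y : ℝ) : ℂ) • (B * R.elem (f (φ x, y)))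
  rw [hB, hφ, hh]

omit hs0 hs

/-- The operator of multiplication by a bounded section over a bisection. -/
noncomputable def bisectionOp (φ : M ≃ M) (b : ∀ x, E.Fib (x, φ x)) (C : ℝ)
    (hb : ∀ x, ‖b x‖ ≤ C) : R.Total →L[ℂ] R.Total :=
  lp.monomial φ (fun x => R.π (b x)) C (fun x => (R.norm_le _).trans (hb x))

theorem bisectionOp_mul_elem (φ : M ≃ M) (b : ∀ x, E.Fib (x, φ x)) (C : ℝ)
    (hb : ∀ x, ‖b x‖ ≤ C) {x y : M} (c : E.Fib (φ x, y)) :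
    R.bisectionOp φ b C hb * R.elem c = R.elem (E.mul (b x) c) := by
  classical
  refine ContinuousLinearMap.ext fun ξ => lp.ext (funext fun j => ?_)
  rw [_root_.mul_apply_eq_comp, bisectionOp, lp.monomial_apply, elem_apply, elem_apply]
  by_cases h : j = x
  · subst h
    rw [lp.single_apply_self, lp.single_apply_self, R.map_mul]
    rfl
  · rw [lp.single_apply_ne _ _ _ h, lp.single_apply_ne _ _ _ (φ.injective.ne h), map_zero]

end FellBundle.HilbertRep

/-! ### Compression to the essential subspace -/

section Compression

set_option linter.unusedSectionVars false

variable {H Γ : Type*} [NormedAddCommGroup H] [InnerProductSpace ℂ H] [CompleteSpace H]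
  [AddCommGroup Γ] [Module ℂ Γ]

/-- The essential subspace of a linear family of operators. -/
def essentialSubspace (T : Γ →ₗ[ℂ] (H →L[ℂ] H)) : Submodule ℂ H :=
  (Submodule.span ℂ (Set.range fun p : Γ × H => T p.1 p.2)).topologicalClosure

instance (T : Γ →ₗ[ℂ] (H →L[ℂ] H)) : CompleteSpace (essentialSubspace T) :=
  (Submodule.isClosed_topologicalClosure _).completeSpace_coe

theorem mem_essentialSubspace (T : Γ →ₗ[ℂ] (H →L[ℂ] H)) (f : Γ) (ξ : H) :
    T f ξ ∈ essentialSubspace T :=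
  Submodule.le_topologicalClosure _ (Submodule.subset_span ⟨(f, ξ), rfl⟩)

theorem eq_zero_of_mem_essentialSubspace (T : Γ →ₗ[ℂ] (H →L[ℂ] H)) {v : H}
    (hv : v ∈ essentialSubspace T) (h : ∀ f ξ, inner ℂ (T f ξ) v = 0) : v = 0 := by
  have h1 : Submodule.span ℂ (Set.range fun p : Γ × H => T p.1 p.2) ≤ (ℂ ∙ v)ᗮ := by
    refine Submodule.span_le.2 ?_
    rintro _ ⟨⟨f, ξ⟩, rfl⟩
    exact Submodule.mem_orthogonal_singleton_iff_inner_left.2 (h f ξ)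
  have h2 := Submodule.topologicalClosure_minimal _ h1 (Submodule.isClosed_orthogonal _) hv
  exact inner_self_eq_zero.1 (Submodule.mem_orthogonal_singleton_iff_inner_left.1 h2)

variable (W : Submodule ℂ H) [CompleteSpace W]

/-- The compression of an operator to a closed subspace. -/
noncomputable def compress : (H →L[ℂ] H) →ₗ[ℂ] (W →L[ℂ] W) where
  toFun B := W.orthogonalProjectionOnto.comp (B.comp W.subtypeL)
  map_add' B C := by rw [ContinuousLinearMap.add_comp, ContinuousLinearMap.comp_add]
  map_smul' t B := by rw [ContinuousLinearMap.smul_comp, ContinuousLinearMap.comp_smul]; rfl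

theorem coe_compress_apply {B : H →L[ℂ] H} {w : W} (h : B w ∈ W) :
    (compress W B w : H) = B w :=
  Submodule.starProjection_eq_self_iff.2 h

/-- Only the inner factor has to preserve `W`: the projection between the factors then acts
trivially. -/
theorem compress_mul {B C : H →L[ℂ] H} (hC : ∀ ξ ∈ W, C ξ ∈ W) :
    compress W (B * C) = compress W B * compress W C := by
  ext1 w
  have h : ((compress W C w : W) : H) = C w := coe_compress_apply W (hC _ w.2)
  change W.orthogonalProjectionOnto (B (C w)) =
    W.orthogonalProjectionOnto (B ((compress W C w : W) : H))
  rw [h]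

theorem compress_star (B : H →L[ℂ] H) : compress W (star B) = star (compress W B) := by
  rw [ContinuousLinearMap.star_eq_adjoint, ContinuousLinearMap.star_eq_adjoint]
  refine (ContinuousLinearMap.eq_adjoint_iff _ _).2 fun v w => ?_
  change inner ℂ (W.orthogonalProjectionOnto (B.adjoint v)) w =
    inner ℂ v (W.orthogonalProjectionOnto (B w))
  rw [Submodule.inner_orthogonalProjectionOnto_eq_of_mem_right,
    Submodule.inner_orthogonalProjectionOnto_eq_of_mem_left,
    ContinuousLinearMap.adjoint_inner_left]

variable (T : Γ →ₗ[ℂ] (H →L[ℂ] H)) (hstar : ∀ f, ∃ g, T g = star (T f))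

include hstar

/-- If `T f` vanishes on the essential subspace, the range of `(T f)*` is orthogonal to every `T f'
ξ`. That range lies in the essential subspace because `(T f)*` belongs to the family, so it is zero.
-/
theorem eq_zero_of_compress (f : Γ) (h : compress (essentialSubspace T) (T f) = 0) : T f = 0 := by
  obtain ⟨g, hg⟩ := hstar f
  have h1 : ∀ w ∈ essentialSubspace T, T f w = 0 := fun w hw => by
    have := coe_compress_apply (essentialSubspace T) (w := ⟨w, hw⟩)
      (mem_essentialSubspace T f w)
    rw [h] at this
    exact this.symm
  have h2 : ∀ w, T g w = 0 := fun w => by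
    refine eq_zero_of_mem_essentialSubspace T (mem_essentialSubspace T g w) fun f' ξ => ?_
    rw [hg, ContinuousLinearMap.star_eq_adjoint, ContinuousLinearMap.adjoint_inner_right,
      h1 _ (mem_essentialSubspace T f' ξ), inner_zero_left]
  have h3 : star (T f) = 0 := by
    rw [← hg]
    exact ContinuousLinearMap.ext h2
  exact star_eq_zero.1 h3

/-- If `v` is orthogonal to the compressed ranges, then `‖T f v‖² = ⟨(T f)* T f v, v⟩ = 0` for all
`f`. By closure under adjoints `v` is then orthogonal to all ranges, hence zero. -/
theorem dense_span_compress : Dense (Submodule.span ℂ (Set.range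
    fun p : Γ × essentialSubspace T => compress (essentialSubspace T) (T p.1) p.2) :
      Set (essentialSubspace T)) := by
  rw [Submodule.dense_iff_topologicalClosure_eq_top, Submodule.topologicalClosure_eq_top_iff,
    Submodule.eq_bot_iff]
  intro v hv
  have h1 : ∀ f, ∀ w ∈ essentialSubspace T, inner ℂ (T f w) (v : H) = 0 := fun f w hw => by
    have := (Submodule.mem_orthogonal _ _).1 hv _ (Submodule.subset_span ⟨(f, ⟨w, hw⟩), rfl⟩)
    rwa [Submodule.coe_inner, coe_compress_apply _ (mem_essentialSubspace T f _)] at this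
  have h2 : ∀ f, T f v = 0 := fun f => by
    obtain ⟨g, hg⟩ := hstar f
    have := h1 g (T f v) (mem_essentialSubspace T f v)
    rw [hg, ContinuousLinearMap.star_eq_adjoint, ContinuousLinearMap.adjoint_inner_left] at this
    exact inner_self_eq_zero.1 this
  refine Subtype.ext (eq_zero_of_mem_essentialSubspace T v.2 fun f ξ => ?_)
  obtain ⟨g, hg⟩ := hstar f
  rw [← ContinuousLinearMap.adjoint_inner_right, ← ContinuousLinearMap.star_eq_adjoint, ← hg, h2,
    inner_zero_right]

end Compression

/-! ### Atomic measures of full support -/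

/-- Positive summable weights on a countable dense set are symmetrised to `s₀ + s₀ ∘ φ`, which is
invariant because `φ` is an involution. -/
theorem exists_invariant_weight {M : Type*} [TopologicalSpace M] [SecondCountableTopology M]
    (φ : M ≃ M) (hφ : ∀ x, φ (φ x) = x) :
    ∃ s : M → ℝ, (∀ x, 0 ≤ s x) ∧ Summable s ∧ (∀ x, s (φ x) = s x) ∧
      Dense (Function.support s) := by
  obtain ⟨D, hD, hDd⟩ := TopologicalSpace.exists_countable_dense M
  have := hD.toEncodable
  obtain ⟨e, he, c, hc, -⟩ := posSumOfEncodable (zero_lt_one' ℝ) D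
  classical
  let s₀ : M → ℝ := fun x => if h : x ∈ D then e ⟨x, h⟩ else 0
  have h0 : ∀ x, 0 ≤ s₀ x := fun x => by
    by_cases h : x ∈ D
    · simp only [s₀, h, dite_true]
      exact (he _).le
    · simp [s₀, h]
  have hs : Summable s₀ := by
    have h1 : Summable fun x : D => s₀ x := by
      refine hc.summable.congr fun x => ?_
      simp [s₀]
    rw [show (fun x : D => s₀ x) = s₀ ∘ (↑) from rfl, summable_subtype_iff_indicator] at h1
    rwa [Set.indicator_eq_self.2] at h1
    intro x hx
    by_contra h
    exact hx (by simp [s₀, h])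
  refine ⟨fun x => s₀ x + s₀ (φ x), fun x => add_nonneg (h0 x) (h0 _),
    hs.add (hs.comp_injective φ.injective), fun x => ?_, hDd.mono fun x hx => ?_⟩
  · change s₀ (φ x) + s₀ (φ (φ x)) = _
    rw [hφ, add_comm]
  · have : 0 < s₀ x := by
      simp only [s₀, hx, dite_true]
      exact he _
    exact (add_pos_of_pos_of_nonneg this (h0 _)).ne'

/-- The measure with mass `s(x)²` at `x`. -/
noncomputable def weightMeasure {M : Type*} [MeasurableSpace M] (s : M → ℝ) : Measure M :=
  Measure.sum fun d : Function.support s => ENNReal.ofReal (s d ^ 2) • Measure.dirac (d : M)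

/-- The measure is a countable sum of point masses on measurable singletons, so a bounded `F` needs
no measurability. -/
theorem integral_weightMeasure {M : Type*} [MeasurableSpace M] [MeasurableSingletonClass M]
    {s : M → ℝ} (hs0 : ∀ x, 0 ≤ s x) (hs : Summable s) {G : Type*} [NormedAddCommGroup G]
    [NormedSpace ℂ G] [CompleteSpace G] {F : M → G} {C : ℝ} (hF : ∀ x, ‖F x‖ ≤ C) :
    ∫ y, F y ∂(weightMeasure s) = ∑' y, ((s y ^ 2 : ℝ) : ℂ) • F y := by
  have := hs.countable_support.to_subtype
  have hr : ∀ d, (ENNReal.ofReal (s d ^ 2)).toReal = s d ^ 2 := fun d =>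
    ENNReal.toReal_ofReal (sq_nonneg _)
  rw [weightMeasure, integral_sum_dirac_eq_tsum (fun _ => ENNReal.ofReal_ne_top)]
  · simp_rw [hr]
    have h1 := tsum_subtype_eq_of_support_subset (s := Function.support s)
      (f := fun y => ((s y ^ 2 : ℝ) : ℂ) • F y) (fun y hy => by
        by_contra h
        rw [Function.notMem_support] at h
        exact hy (by simp [h]))
    rw [← h1]
    rfl
  · simp_rw [hr]
    refine Summable.of_nonneg_of_le (fun d => by positivity) (fun d => ?_)
      (((summable_sq_of_nonneg hs0 hs).mul_right C).comp_injective Subtype.val_injective)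
    exact mul_le_mul_of_nonneg_left (hF _) (sq_nonneg _)

theorem isFiniteMeasure_weightMeasure {M : Type*} [MeasurableSpace M]
    {s : M → ℝ} (hs0 : ∀ x, 0 ≤ s x) (hs : Summable s) : IsFiniteMeasure (weightMeasure s) := by
  refine ⟨?_⟩
  rw [weightMeasure, Measure.sum_apply _ MeasurableSet.univ]
  simp only [Measure.smul_apply, measure_univ, smul_eq_mul, mul_one]
  have h1 : Summable fun d : Function.support s => s d ^ 2 :=
    (summable_sq_of_nonneg hs0 hs).comp_injective Subtype.val_injective
  rw [← ENNReal.ofReal_tsum_of_nonneg (fun _ => sq_nonneg _) h1]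
  exact ENNReal.ofReal_lt_top

theorem isOpenPosMeasure_weightMeasure {M : Type*} [TopologicalSpace M] [MeasurableSpace M]
    [OpensMeasurableSpace M] {s : M → ℝ} (hd : Dense (Function.support s)) :
    (weightMeasure s).IsOpenPosMeasure := by
  refine ⟨fun U hU hne h0 => ?_⟩
  obtain ⟨x, hxU, hx⟩ := hd.inter_open_nonempty U hU hne
  rw [weightMeasure, Measure.sum_apply _ hU.measurableSet, ENNReal.tsum_eq_zero] at h0
  have := h0 ⟨x, hx⟩
  rw [Measure.smul_apply, Measure.dirac_apply' _ hU.measurableSet,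
    Set.indicator_of_mem hxU, Pi.one_apply, smul_eq_mul, mul_one, ENNReal.ofReal_eq_zero] at this
  exact hx (pow_eq_zero_iff two_ne_zero |>.1 (le_antisymm this (sq_nonneg _)))

/-! ### The regular representation of a Fell bundle -/

namespace FellBundle

set_option linter.unusedSectionVars false

variable {M : Type u} [TopologicalSpace M]

theorem exists_norm_le_of_continuous {X : Type*} [TopologicalSpace X] [CompactSpace X]
    (E : FellBundle M) {f : X → Tot E.Fib} (hf : Continuous f) : ∃ C, ∀ x, ‖(f x).val‖ ≤ C := by
  obtain ⟨C, hC⟩ := isCompact_univ.exists_bound_of_continuousOn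
    (E.banach.continuous_norm.comp hf).continuousOn
  exact ⟨C, fun x => by simpa using hC x (Set.mem_univ x)⟩

theorem continuous_mul_comp (E : FellBundle M) {X : Type*} [TopologicalSpace X] {x y z : X → M}
    {a : ∀ t, E.Fib (x t, y t)} {b : ∀ t, E.Fib (y t, z t)}
    (ha : Continuous fun t => (⟨(x t, y t), a t⟩ : Tot E.Fib))
    (hb : Continuous fun t => (⟨(y t, z t), b t⟩ : Tot E.Fib)) :
    Continuous fun t => (⟨(x t, z t), E.mul (a t) (b t)⟩ : Tot E.Fib) := by
  have h : Continuous fun t => (⟨x t, y t, z t, a t, b t⟩ : Composable E.Fib) :=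
    continuous_induced_rng.2 (ha.prodMk hb)
  exact E.continuous_mul.comp h

variable [CompactSpace M]

theorem exists_norm_le (E : FellBundle M) (f : E.sections) : ∃ C, ∀ g, ‖f.1 g‖ ≤ C :=
  E.exists_norm_le_of_continuous f.2

/-- Convolution of sections with respect to the measure with masses `s(y)²`. -/
noncomputable def conv (E : FellBundle M) {s : M → ℝ} (hs0 : ∀ x, 0 ≤ s x) (hs : Summable s)
    (f g : E.sections) : E.sections :=
  ⟨fun p => ∑' y, ((s y ^ 2 : ℝ) : ℂ) • E.mul (f.1 (p.1, y)) (g.1 (y, p.2)), by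
    obtain ⟨C, hC⟩ := E.exists_norm_le f
    obtain ⟨D, hD⟩ := E.exists_norm_le g
    have hsq := summable_sq_of_nonneg hs0 hs
    refine E.banach.continuous_of_approxAt fun ε hε => ?_
    -- The finite partial sums are continuous sections, and the tails are bounded uniformly in `p`
    -- by those of `∑ s(y)² |C| |D|`. Absolute values are used because `C` and `D` need not be
    -- nonnegative when `M` is empty.
    have htail := (tendsto_tsum_compl_atTop_zero fun y => s y ^ 2 * (|C| * |D|)).eventually
      (gt_mem_nhds hε)
    obtain ⟨F, hF⟩ := htail.exists
    have hterm : ∀ y, (fun p : M × M => ((s y ^ 2 : ℝ) : ℂ) • E.mul (f.1 (p.1, y)) (g.1 (y, p.2)))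
        ∈ E.sections := fun y => by
      refine E.sections.smul_mem _ ?_
      refine E.continuous_mul_comp (x := fun p : M × M => p.1) (y := fun _ => y)
        (z := fun p => p.2) (a := fun p => f.1 (p.1, y)) (b := fun p => g.1 (y, p.2)) ?_ ?_
      · exact f.2.comp (continuous_fst.prodMk continuous_const)
      · exact g.2.comp (continuous_const.prodMk continuous_snd)
    refine ⟨fun p => ∑ y ∈ F, ((s y ^ 2 : ℝ) : ℂ) • E.mul (f.1 (p.1, y)) (g.1 (y, p.2)),
      fun p => ?_, fun p => ?_⟩
    · have hsum := E.sections.sum_mem (t := F) fun y _ => hterm y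
      have hc : Continuous fun p : M × M => (⟨p, ∑ y ∈ F, ((s y ^ 2 : ℝ) : ℂ) •
          E.mul (f.1 (p.1, y)) (g.1 (y, p.2))⟩ : Tot E.Fib) := by
        convert (show Continuous _ from hsum) using 3 with p
        rw [Finset.sum_apply]
      exact (IsBanachBundle.approxAt_of_continuousAt hc.continuousAt).mono hε.le
    · have := E.banach.complete p
      have hc := HilbertRep.summable_conv (E := E) hs0 hs hC hD p.1 p.2
      rw [← hc.sum_add_tsum_compl (s := F), add_sub_cancel_left]
      refine le_trans (tsum_of_norm_bounded (((hsq.mul_right (|C| * |D|)).comp_injective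
        Subtype.val_injective).hasSum) fun y => ?_) hF.le
      rw [norm_smul, Complex.norm_real, Real.norm_of_nonneg (sq_nonneg _)]
      refine mul_le_mul_of_nonneg_left ((E.norm_mul_le _ _).trans ?_) (sq_nonneg _)
      exact mul_le_mul ((hC _).trans (le_abs_self C)) ((hD _).trans (le_abs_self D))
        (norm_nonneg _) (abs_nonneg C)⟩

/-- The adjoint of a section. -/
noncomputable def sectionAdj (E : FellBundle M) (f : E.sections) : E.sections :=
  ⟨fun p => E.adj (f.1 (p.2, p.1)),
    E.continuous_adj.comp (f.2.comp (continuous_snd.prodMk continuous_fst))⟩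

/-- The product of a section over the units with a section. -/
noncomputable def diagMul (E : FellBundle M) (a : E.diagSections) (f : E.sections) : E.sections :=
  ⟨fun p => E.mul (a.1 p.1) (f.1 p),
    E.continuous_mul_comp (x := fun p : M × M => p.1) (y := fun p => p.1) (z := fun p => p.2)
      (a.2.comp continuous_fst) f.2⟩

/-! ### From a faithful family of operators to a completion and a representation -/

section OfOperators

variable {E : FellBundle M} {s : M → ℝ} (hs0 : ∀ x, 0 ≤ s x) (hs : Summable s)
  {H : Type u} [NormedAddCommGroup H] [InnerProductSpace ℂ H] [CompleteSpace H]
  (τ : E.sections →ₗ[ℂ] (H →L[ℂ] H))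
  (hmul : ∀ f g h : E.sections, (∀ x z, h.1 (x, z) =
    ∑' y, ((s y ^ 2 : ℝ) : ℂ) • E.mul (f.1 (x, y)) (g.1 (y, z))) → τ h = τ f * τ g)
  (hstar : ∀ f h : E.sections, (∀ x y, h.1 (x, y) = E.adj (f.1 (y, x))) → τ h = star (τ f))

/-- The `*`-algebra of the operators of a represented convolution algebra. -/
noncomputable def operatorAlgebra : NonUnitalStarSubalgebra ℂ (H →L[ℂ] H) where
  carrier := Set.range τ
  add_mem' := by
    rintro _ _ ⟨f, rfl⟩ ⟨g, rfl⟩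
    exact ⟨f + g, map_add _ _ _⟩
  zero_mem' := ⟨0, map_zero _⟩
  mul_mem' := by
    rintro _ _ ⟨f, rfl⟩ ⟨g, rfl⟩
    exact ⟨E.conv hs0 hs f g, hmul f g _ fun _ _ => rfl⟩
  smul_mem' := by
    rintro t _ ⟨f, rfl⟩
    exact ⟨t • f, map_smul _ _ _⟩
  star_mem' := by
    rintro _ ⟨f, rfl⟩
    exact ⟨E.sectionAdj f, hstar f _ fun _ _ => rfl⟩

/-- The C*-completion given by a faithful representation of the convolution algebra. -/
noncomputable def Completion.ofOperators [T2Space M] (hinj : Function.Injective τ) :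
    E.Completion (@weightMeasure M (borel M) s) :=
  letI : MeasurableSpace M := borel M
  haveI : BorelSpace M := ⟨rfl⟩
  haveI : IsClosed ((operatorAlgebra hs0 hs τ hmul hstar).topologicalClosure :
      Set (H →L[ℂ] H)) :=
    (operatorAlgebra hs0 hs τ hmul hstar).isClosed_topologicalClosure
  { Alg := (operatorAlgebra hs0 hs τ hmul hstar).topologicalClosure
    ι := τ.codRestrict
      (operatorAlgebra hs0 hs τ hmul hstar).topologicalClosure.toNonUnitalSubalgebra.toSubmodule
      fun f => (operatorAlgebra hs0 hs τ hmul hstar).le_topologicalClosure ⟨f, rfl⟩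
    injective := fun f g h => hinj (congrArg Subtype.val h)
    denseRange := by
      rintro ⟨a, ha⟩
      refine closure_subtype.2 ?_
      rw [← Set.range_comp]
      exact ha
    map_conv := fun f g h hh => Subtype.ext (hmul f g h fun x z => by
      obtain ⟨C, hC⟩ := E.exists_norm_le f
      obtain ⟨D, hD⟩ := E.exists_norm_le g
      have := E.banach.complete (x, z)
      rw [hh]
      refine integral_weightMeasure hs0 hs (C := |C| * |D|) fun y => (E.norm_mul_le _ _).trans ?_
      exact mul_le_mul ((hC _).trans (le_abs_self C)) ((hD _).trans (le_abs_self D))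
        (norm_nonneg _) (abs_nonneg C))
    map_star := fun f h hh => Subtype.ext (hstar f h hh) }

variable (hnd : Dense (Submodule.span ℂ (Set.range fun p : E.sections × H => τ p.1 p.2) : Set H))

include hnd in
theorem eq_of_mul_operators {A B : H →L[ℂ] H} (h : ∀ f, A * τ f = B * τ f) : A = B := by
  refine ContinuousLinearMap.ext_on hnd ?_
  rintro _ ⟨⟨f, ξ⟩, rfl⟩
  exact congrArg (fun X : H →L[ℂ] H => X ξ) (h f)

include hnd in
-- Nondegeneracy cancels `τ f` on the right and, after taking adjoints, `(τ g)*` on the left. It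
-- serves to identify adjoints of operators known only through their products with the `τ f`.
theorem eq_of_star_mul_operators {A B : H →L[ℂ] H}
    (h : ∀ f g, star (τ g) * (A * τ f) = star (τ g) * (B * τ f)) : A = B := by
  refine eq_of_mul_operators τ hnd fun f => ?_
  refine star_injective (eq_of_mul_operators τ hnd fun g => star_injective ?_)
  simpa only [star_mul, star_star] using h f g

variable (D : E.diagSections → (H →L[ℂ] H))
  (hD : ∀ (a : E.diagSections) (f h : E.sections),
    (∀ x y, h.1 (x, y) = E.mul (a.1 x) (f.1 (x, y))) → τ h = D a * τ f)

/-- A Hilbert space with a faithful nondegenerate representation of the convolution algebra and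
compatible operators for the sections over the units. -/
noncomputable def Representation.ofOperators [T2Space M] (hd : Dense (Function.support s))
    (hinj : Function.Injective τ) : E.Representation :=
  letI : MeasurableSpace M := borel M
  haveI : BorelSpace M := ⟨rfl⟩
  { μ := weightMeasure s
    finite := isFiniteMeasure_weightMeasure hs0 hs
    openPos := isOpenPosMeasure_weightMeasure hd
    completion := Completion.ofOperators hs0 hs τ hmul hstar hinj
    H := H
    ρ := NonUnitalStarSubalgebraClass.subtype
      (operatorAlgebra hs0 hs τ hmul hstar).topologicalClosure
    faithful := Subtype.val_injective
    nondegenerate := hnd.mono (Submodule.span_mono (by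
      rintro _ ⟨⟨f, ξ⟩, rfl⟩
      exact ⟨((Completion.ofOperators hs0 hs τ hmul hstar hinj).ι f, ξ), rfl⟩))
    ρ₀ :=
      { toFun := D
        -- Linearity of `D` is not assumed; it is forced by the products with the `τ f`.
        map_add' := fun a b => eq_of_mul_operators τ hnd fun f => by
          rw [← hD (a + b) f (E.diagMul a f + E.diagMul b f) fun x y => (E.add_mul _ _ _).symm,
            map_add, hD a f (E.diagMul a f) fun _ _ => rfl,
            hD b f (E.diagMul b f) fun _ _ => rfl, _root_.add_mul]
        map_smul' := fun t a => eq_of_mul_operators τ hnd fun f => by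
          rw [← hD (t • a) f (t • E.diagMul a f) fun x y => (E.smul_mul _ _ _).symm,
            map_smul, hD a f (E.diagMul a f) fun _ _ => rfl, smul_mul_assoc, RingHom.id_apply] }
    ρ₀_mul := fun a b c hc => eq_of_mul_operators τ hnd fun f => by
      have h1 := hD a (E.diagMul b f) (E.diagMul a (E.diagMul b f)) fun _ _ => rfl
      have h2 := hD b f (E.diagMul b f) fun _ _ => rfl
      have h3 := hD c f (E.diagMul a (E.diagMul b f)) fun x y => by
        rw [hc]
        exact (E.mul_assoc _ _ _).symm
      change D c * τ f = D a * D b * τ f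
      rw [← h3, h1, h2, _root_.mul_assoc]
    -- With `b = a*` pointwise, the convolutions `g* * (b f)` and `(a g)* * f` are the same section.
    ρ₀_star := fun a b hb => eq_of_star_mul_operators τ hnd fun f g => by
      have h1 := hD a g (E.diagMul a g) fun _ _ => rfl
      have h2 := hD b f (E.diagMul b f) fun _ _ => rfl
      have h3 := hmul (E.sectionAdj g) (E.diagMul b f)
        (E.conv hs0 hs (E.sectionAdj g) (E.diagMul b f)) fun _ _ => rfl
      have h4 := hmul (E.sectionAdj (E.diagMul a g)) f
        (E.conv hs0 hs (E.sectionAdj g) (E.diagMul b f)) fun x z => by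
          refine tsum_congr fun y => congrArg _ ?_
          change E.mul (E.adj (g.1 (y, x))) (E.mul (b.1 y) (f.1 (y, z))) =
            E.mul (E.adj (E.mul (a.1 y) (g.1 (y, x)))) (f.1 (y, z))
          rw [hb, E.adj_mul, E.mul_assoc]
      rw [hstar g (E.sectionAdj g) fun _ _ => rfl] at h3
      rw [hstar (E.diagMul a g) (E.sectionAdj (E.diagMul a g)) fun _ _ => rfl, h1, star_mul, _root_.mul_assoc] at h4
      change star (τ g) * (D b * τ f) = star (τ g) * (star (D a) * τ f)
      rw [← h4, h3, h2]
    ρ₀_compat := fun a f h hh => hD a f h hh }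

end OfOperators

/-! ### Continuous kernels on their essential subspace -/

variable {E : FellBundle M} (R : E.HilbertRep) {s : M → ℝ} (hs0 : ∀ x, 0 ≤ s x) (hs : Summable s)

/-- The operators with continuous kernels. -/
noncomputable def sectionOp : E.sections →ₗ[ℂ] (R.Total →L[ℂ] R.Total) where
  toFun f := R.kernelOp s f.1
  map_add' f g := by
    obtain ⟨C, hC⟩ := E.exists_norm_le f
    obtain ⟨D, hD⟩ := E.exists_norm_le g
    exact R.kernelOp_add hs0 hs hC hD
  map_smul' t f := R.kernelOp_smul t f.1

/-- The essential subspace of the operators with continuous kernels. -/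
abbrev EssentialSpace : Type u := essentialSubspace (sectionOp R hs0 hs)

/-- The operators with continuous kernels, on their essential subspace. -/
noncomputable def regularOp :
    E.sections →ₗ[ℂ] (EssentialSpace R hs0 hs →L[ℂ] EssentialSpace R hs0 hs) :=
  (compress (essentialSubspace (sectionOp R hs0 hs))).comp (sectionOp R hs0 hs)

theorem sectionOp_star {f h : E.sections} (hh : ∀ x y, h.1 (x, y) = E.adj (f.1 (y, x))) :
    sectionOp R hs0 hs h = star (sectionOp R hs0 hs f) :=
  R.star_kernelOp hh

theorem exists_sectionOp_star (f : E.sections) :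
    ∃ g, sectionOp R hs0 hs g = star (sectionOp R hs0 hs f) :=
  ⟨E.sectionAdj f, sectionOp_star R hs0 hs fun _ _ => rfl⟩

theorem sectionOp_mul {f g h : E.sections} (hh : ∀ x z, h.1 (x, z) =
    ∑' y, ((s y ^ 2 : ℝ) : ℂ) • E.mul (f.1 (x, y)) (g.1 (y, z))) :
    sectionOp R hs0 hs h = sectionOp R hs0 hs f * sectionOp R hs0 hs g := by
  obtain ⟨C, hC⟩ := E.exists_norm_le f
  obtain ⟨D, hD⟩ := E.exists_norm_le g
  exact R.kernelOp_mul hs0 hs hC hD hh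

theorem regularOp_star {f h : E.sections} (hh : ∀ x y, h.1 (x, y) = E.adj (f.1 (y, x))) :
    regularOp R hs0 hs h = star (regularOp R hs0 hs f) := by
  rw [regularOp, LinearMap.comp_apply, sectionOp_star R hs0 hs hh, compress_star]
  rfl

theorem regularOp_mul {f g h : E.sections} (hh : ∀ x z, h.1 (x, z) =
    ∑' y, ((s y ^ 2 : ℝ) : ℂ) • E.mul (f.1 (x, y)) (g.1 (y, z))) :
    regularOp R hs0 hs h = regularOp R hs0 hs f * regularOp R hs0 hs g := by
  rw [regularOp, LinearMap.comp_apply, sectionOp_mul R hs0 hs hh, compress_mul]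
  · rfl
  · exact fun ξ _ => mem_essentialSubspace _ g ξ

/-- Compression loses nothing, the entries of a vanishing operator are zero on the dense set where
both weights are nonzero, and the norm of a section is continuous. -/
theorem injective_regularOp (hE : E.IsUnital) (hd : Dense (Function.support s)) :
    Function.Injective (regularOp R hs0 hs) := by
  refine (injective_iff_map_eq_zero _).2 fun f hf => ?_
  have h1 := eq_zero_of_compress _ (exists_sectionOp_star R hs0 hs) f hf
  obtain ⟨C, hC⟩ := E.exists_norm_le f
  have h2 : ∀ g ∈ Function.support s ×ˢ Function.support s, ‖f.1 g‖ = 0 := fun g hg => by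
    rw [norm_eq_zero]
    exact R.eq_zero_of_kernelOp hs0 hs hE hC h1 hg.1 hg.2
  have h3 : (fun g => ‖f.1 g‖) = fun _ => 0 :=
    (E.banach.continuous_norm.comp f.2).ext_on (hd.prod hd) continuous_const h2
  exact Subtype.ext (funext fun g => norm_eq_zero.1 (congrFun h3 g))


theorem mul_sectionOp (φ : M ≃ M) (hφ : ∀ x, s (φ x) = s x) {b : ∀ x, E.Fib (x, φ x)} {C : ℝ}
    (hb : ∀ x, ‖b x‖ ≤ C) {f h : E.sections}
    (hh : ∀ x y, h.1 (x, y) = E.mul (b x) (f.1 (φ x, y))) :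
    sectionOp R hs0 hs h = R.bisectionOp φ b C hb * sectionOp R hs0 hs f := by
  obtain ⟨D, hD⟩ := E.exists_norm_le f
  exact R.mul_kernelOp hs0 hs φ hφ (R.bisectionOp_mul_elem φ b C hb) hD hh

/-- Bounded operators implement the multiplication by continuous sections along bisections which
preserve the weights. -/
theorem exists_operator (φ : M ≃ₜ M) (hφ : ∀ x, s (φ x) = s x) (b : ∀ x, E.Fib (x, φ x))
    (hb : Continuous fun x => (⟨(x, φ x), b x⟩ : Tot E.Fib)) :
    ∃ B : EssentialSpace R hs0 hs →L[ℂ] EssentialSpace R hs0 hs, ∀ f h : E.sections,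
      (∀ x y, h.1 (x, y) = E.mul (b x) (f.1 (φ x, y))) →
        regularOp R hs0 hs h = B * regularOp R hs0 hs f := by
  obtain ⟨C, hC⟩ := E.exists_norm_le_of_continuous hb
  refine ⟨compress _ (R.bisectionOp φ.toEquiv b C hC), fun f h hh => ?_⟩
  rw [regularOp, LinearMap.comp_apply, mul_sectionOp R hs0 hs φ.toEquiv hφ hC hh, compress_mul]
  · rfl
  · exact fun ξ _ => mem_essentialSubspace _ f ξ

variable (E) in
/-- Every continuous self-adjoint section along a bisection extends to a bounded operator on the
space of a suitable representation. -/
theorem exists_representation [T2Space M] [SecondCountableTopology M] (hE : E.IsUnital)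
    (φ : M ≃ₜ M) (hφ : ∀ x, φ (φ x) = x) (b : ∀ x, E.Fib (x, φ x))
    (hb : Continuous fun x => (⟨(x, φ x), b x⟩ : Tot E.Fib)) :
    ∃ (R : E.Representation) (B : R.H →L[ℂ] R.H), ∀ f h : E.sections,
      (∀ x y, h.1 (x, y) = E.mul (b x) (f.1 (φ x, y))) →
        R.ρ (R.completion.ι h) = B * R.ρ (R.completion.ι f) := by
  obtain ⟨s, hs0, hs, hsφ, hd⟩ := exists_invariant_weight φ.toEquiv hφ
  let R := universalRep hE
  obtain ⟨B, hB⟩ := exists_operator R hs0 hs φ hsφ b hb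
  -- Sections over the units are sections along the trivial bisection, which preserves every weight.
  have hdiag : ∀ a : E.diagSections, ∃ A : EssentialSpace R hs0 hs →L[ℂ] EssentialSpace R hs0 hs,
      ∀ f h : E.sections, (∀ x y, h.1 (x, y) = E.mul (a.1 x) (f.1 (x, y))) →
        regularOp R hs0 hs h = A * regularOp R hs0 hs f := fun a =>
    exists_operator R hs0 hs (Homeomorph.refl M) (fun _ => rfl) a.1 a.2
  choose D hD using hdiag
  exact ⟨Representation.ofOperators hs0 hs (regularOp R hs0 hs)
    (fun f g h hh => regularOp_mul R hs0 hs hh) (fun f h hh => regularOp_star R hs0 hs hh)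
    (dense_span_compress _ (exists_sectionOp_star R hs0 hs)) D hD hd
    (injective_regularOp R hs0 hs hE hd), B, hB⟩

end FellBundle

/-! ### Path-lifting operators and their sections -/

namespace FellBundle

variable {M : Type u} [TopologicalSpace M]

/-- Approximate `1_x` by sums of products `b c` through `y`; then `a = 1_x a` is approximated by the
sums of `b (c a)`. -/
theorem isSaturated_of_full (E : FellBundle M) (h : E.IsUnital)
    (hfull : ∀ x y : M, Dense (Submodule.span ℂ
      (Set.range fun p : E.Fib (x, y) × E.Fib (y, x) => E.mul p.1 p.2) : Set (E.Fib (x, x)))) :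
    E.IsSaturated := by
  intro x y z a
  let S := Submodule.span ℂ (Set.range fun p : E.Fib (x, y) × E.Fib (y, z) => E.mul p.1 p.2)
  let m : E.Fib (x, x) →ₗ[ℂ] E.Fib (x, z) :=
    { toFun := fun b => E.mul b a
      map_add' := fun b c => E.add_mul b c a
      map_smul' := fun t b => E.smul_mul t b a }
  have hm : Continuous m := (LinearMap.mkContinuous m ‖a‖ fun b => by
    rw [mul_comm]
    exact E.norm_mul_le b a).continuous
  have hle : Submodule.span ℂ (Set.range fun p : E.Fib (x, y) × E.Fib (y, x) => E.mul p.1 p.2) ≤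
      S.comap m := by
    refine Submodule.span_le.2 ?_
    rintro _ ⟨⟨b, c⟩, rfl⟩
    refine Submodule.subset_span ⟨(b, E.mul c a), ?_⟩
    exact (E.mul_assoc b c a).symm
  have h1 : m (E.one h x) ∈ closure (S : Set (E.Fib (x, z))) :=
    map_mem_closure hm (hfull x y (E.one h x)) fun b hb => hle hb
  rwa [show m (E.one h x) = a from E.identity_mul (E.one_isIdentity h x) a] at h1

theorem totAdj_totAdj (E : FellBundle M) (e : Tot E.Fib) : E.totAdj (E.totAdj e) = e := by
  obtain ⟨⟨x, y⟩, a⟩ := e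
  simp only [totAdj, E.adj_adj]

section Consistent

variable {E : FellBundle M} {φ : M → M} {e : ∀ x : M, E.Fib (φ x, x)}
  (he : ∀ x, (⟨(φ (φ x), φ x), e (φ x)⟩ : Tot E.Fib) = E.totAdj ⟨(φ x, x), e x⟩)

include he

/-- Multiplication by a consistent section, in terms of its adjoint. -/
theorem forall_eq_mul_iff_of_consistent {f h : ∀ g, E.Fib g} :
    (∀ x z, h (φ x, z) = E.mul (e x) (f (x, z))) ↔
      ∀ x z, h (x, z) = E.mul (E.adj (e x)) (f (φ x, z)) := by
  constructor
  · intro hh x z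
    -- Consistency equates elements of fibres over different expressions for one arrow; generalising
    -- over the total space avoids casts.
    have key : ∀ t : Tot E.Fib, t = ⟨(φ (φ x), φ x), e (φ x)⟩ →
        h (t.base.1, z) = E.mul t.val (f (t.base.2, z)) := by
      rintro t rfl
      exact hh (φ x) z
    exact key (E.totAdj ⟨(φ x, x), e x⟩) (he x).symm
  · intro hh x z
    have key : ∀ t : Tot E.Fib, t = E.totAdj ⟨(φ (φ x), φ x), e (φ x)⟩ →
        h (t.base.1, z) = E.mul t.val (f (t.base.2, z)) := by
      rintro t rfl
      exact hh (φ x) z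
    refine key ⟨(φ x, x), e x⟩ ?_
    rw [he, E.totAdj_totAdj]

/-- In its adjoint form the condition is an explicit formula for `h(x,z)`, visibly continuous. -/
theorem exists_section_mul_of_consistent (hφ : Continuous φ)
    (hc : Continuous fun x => (⟨(φ x, x), e x⟩ : Tot E.Fib)) (f : E.sections) :
    ∃ h : E.sections, ∀ x z, h.1 (φ x, z) = E.mul (e x) (f.1 (x, z)) := by
  have hadj : Continuous fun x => (⟨(x, φ x), E.adj (e x)⟩ : Tot E.Fib) :=
    E.continuous_adj.comp hc
  refine ⟨⟨fun p => E.mul (E.adj (e p.1)) (f.1 (φ p.1, p.2)), ?_⟩,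
    (forall_eq_mul_iff_of_consistent he).2 fun x z => rfl⟩
  exact E.continuous_mul_comp (x := fun p : M × M => p.1) (y := fun p => φ p.1)
    (z := fun p => p.2) (hadj.comp continuous_fst)
    (f.2.comp ((hφ.comp continuous_fst).prodMk continuous_snd))

end Consistent

/-- Elements of a fibre are determined by their products with the continuous sections. -/
theorem eq_of_forall_mul_section [CompactSpace M] [T2Space M] {E : FellBundle M}
    (h : E.IsUnital) {x y : M} {a b : E.Fib (x, y)}
    (hab : ∀ f : E.sections, E.mul a (f.1 (y, y)) = E.mul b (f.1 (y, y))) : a = b := by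
  -- Since `(a - b) f(y,y) = 0`, one has `(a - b)(f(y,y) - 1) = b - a`, so `‖a - b‖ ≤ ‖a - b‖ / 2`.
  obtain ⟨f, hf, hf1⟩ := E.banach.exists_section_near (E.one h y) (δ := 1 / 2) (by norm_num)
  have h1 : E.mul (a - b) (f (y, y) - E.one h y) = b - a := by
    rw [E.mul_sub, E.mul_identity (E.one_isIdentity h y), E.sub_mul, hab ⟨f, hf⟩, sub_self,
      zero_sub, neg_sub]
  have h2 := E.norm_mul_le (a - b) (f (y, y) - E.one h y)
  rw [h1, norm_sub_rev b a] at h2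
  have h3 : ‖a - b‖ ≤ ‖a - b‖ * (1 / 2) :=
    h2.trans (mul_le_mul_of_nonneg_left hf1 (norm_nonneg _))
  exact sub_eq_zero.1 (norm_eq_zero.1 (le_antisymm (by linarith) (norm_nonneg _)))

/-- A bounded operator is determined by its products with the operators of sections. -/
theorem Representation.eq_of_mul_section {E : FellBundle M} (R : E.Representation)
    {A B : R.H →L[ℂ] R.H}
    (h : ∀ f : E.sections, A * R.ρ (R.completion.ι f) = B * R.ρ (R.completion.ι f)) : A = B := by
  have hρ : Continuous R.ρ := AddMonoidHomClass.continuous_of_bound R.ρ 1 fun a => by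
    simpa using NonUnitalStarAlgHom.norm_apply_le R.ρ a
  have h1 : (fun a => A * R.ρ a) = fun a => B * R.ρ a :=
    R.completion.denseRange.equalizer (by fun_prop) (by fun_prop) (funext h)
  refine ContinuousLinearMap.ext_on R.nondegenerate ?_
  rintro _ ⟨⟨a, ξ⟩, rfl⟩
  exact congrArg (fun X : R.H →L[ℂ] R.H => X ξ) (congrFun h1 a)

/-- Path-lifting operators over the same bisection correspond to their sections. -/
theorem PathLifting.eq_iff [CompactSpace M] [T2Space M] {E : FellBundle M} (hE : E.IsUnital)
    {R : E.Representation} (L L' : E.PathLifting R) (hφ : L.φ = L'.φ) :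
    L.PL = L'.PL ↔ ∀ x, L.arrow x = L'.arrow x := by
  obtain ⟨φ, e, hc, he, B, hB⟩ := L
  obtain ⟨φ', e', hc', he', B', hB'⟩ := L'
  obtain rfl : φ = φ' := hφ
  constructor
  · rintro (rfl : B = B') x
    have hx : e x = e' x := by
      refine eq_of_forall_mul_section hE fun f => ?_
      obtain ⟨h, hh⟩ := exists_section_mul_of_consistent he φ.continuous hc f
      obtain ⟨h', hh'⟩ := exists_section_mul_of_consistent he' φ.continuous hc' f
      have heq : h = h' := R.completion.injective (R.faithful ((hB f h hh).trans (hB' f h' hh').symm))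
      rw [← hh, ← hh', heq]
    simp only [PathLifting.arrow, hx]
  · intro harrow
    have hee : e = e' := funext fun x => by
      have := harrow x
      simpa [PathLifting.arrow] using this
    subst hee
    refine R.eq_of_mul_section fun f => ?_
    obtain ⟨h, hh⟩ := exists_section_mul_of_consistent he φ.continuous hc f
    exact (hB f h hh).symm.trans (hB' f h hh)

end FellBundle

/-! ### The equivalence -/

/-- With one object map on both sides the `eqToHom` factors of `Functor.congr_hom` are identities.
-/
theorem CategoryTheory.Functor.map_eq_of_mk_eq {C D : Type*} [Category* C] [Category* D]
    {o : C → D} {m m' : ∀ {X Y : C}, (X ⟶ Y) → (o X ⟶ o Y)} {h₁ h₂ h₁' h₂'}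
    (h : (⟨o, m, h₁, h₂⟩ : C ⥤ D) = ⟨o, m', h₁', h₂'⟩) (X Y : C) (f : X ⟶ Y) :
    m f = m' f := by
  simpa using Functor.congr_hom h f

namespace FellBundleTriple

variable {P : ∀ (M : Type u) [TopologicalSpace M], Prop}

instance : (toSpectral P).Faithful where
  map_injective := fun {S T} F G h => by
    obtain ⟨b, m, _, _, _, _, _, _⟩ := F
    obtain ⟨b', m', _, _, _, _, _, _⟩ := G
    have h1 := congrArg SpectralCStarCategory.Hom.functor h
    have hb : b = b' := congrArg (fun F => F.obj) h1
    subst hb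
    have hm : ∀ x y a, m x y a = m' x y a := fun x y a => by
      exact Functor.map_eq_of_mk_eq (C := S.spectralCStarCategory.Ob)
        (D := T.spectralCStarCategory.Ob) h1 y x a
    obtain rfl : m = m' := funext fun x => funext fun y => LinearMap.ext (hm x y)
    rfl

instance : (toSpectral P).Full where
  map_surjective := fun {S T} F =>
    ⟨{ base := F.functor.obj
       map := fun x y =>
        { toFun := fun a => F.functor.map (X := y) (Y := x) a
          map_add' := fun a b => F.map_add (x := y) (y := x) a b
          map_smul' := fun t a => F.map_smul (x := y) (y := x) t a }
       continuous_base := F.continuous_obj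
       continuous_map := F.continuous_map
       map_mul := fun {x y z} a b => F.functor.map_comp (X := z) (Y := y) (Z := x) b a
       map_adj := fun {x y} a => F.map_adj (x := y) (y := x) a
       map_identity := fun {x} a ha => by
        have h1 : a = S.E.one S.unital x := ha.eq (S.E.one_isIdentity S.unital x)
        subst h1
        have h2 := F.functor.map_id x
        exact (congrArg (fun u : T.E.Fib (F.functor.obj x, F.functor.obj x) =>
          T.E.IsIdentity u) h2).mpr (T.E.one_isIdentity T.unital (F.functor.obj x))
       map_lift := fun x => F.map_σ x }, rfl⟩

end FellBundleTriple

/-- The Fell bundle of a fibred C*-category. -/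
def FibredCStarCategory.fellBundle (C : Type u) [Category.{u} C] [TopologicalSpace C]
    [FibredCStarCategory C] : FellBundle C where
  Fib := HomFam C
  normed := fun g => CStarCategory.normed g.2 g.1
  space := fun g => CStarCategory.space g.2 g.1
  top := FibredCStarCategory.top
  banach := FibredCStarCategory.banach
  mul := fun {x y z} a b => (show z ⟶ y from b) ≫ (show y ⟶ x from a)
  adj := fun {x y} a => CStarCategory.adj (x := y) (y := x) a
  continuous_mul := FibredCStarCategory.continuous_comp
  continuous_adj := FibredCStarCategory.continuous_adj
  add_mul := fun a b c => CStarCategory.comp_add c a b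
  mul_add := fun a b c => CStarCategory.add_comp b c a
  smul_mul := fun t a b => CStarCategory.comp_smul t b a
  mul_smul := fun t a b => CStarCategory.smul_comp t b a
  mul_assoc := fun a b c => (Category.assoc c b a).symm
  norm_mul_le := fun a b => CStarCategory.norm_comp_le b a
  adj_add := fun a b => CStarCategory.adj_add a b
  adj_smul := fun t a => CStarCategory.adj_smul t a
  adj_adj := fun a => CStarCategory.adj_adj a
  adj_mul := fun a b => CStarCategory.adj_comp b a
  norm_adj_mul := fun a => CStarCategory.norm_comp_adj a
  adj_mul_pos := fun a => CStarCategory.comp_adj_pos a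


theorem FibredCStarCategory.isUnital_fellBundle (C : Type u) [Category.{u} C] [TopologicalSpace C]
    [FibredCStarCategory C] : (FibredCStarCategory.fellBundle C).IsUnital := fun x =>
  ⟨𝟙 x, fun a => ⟨Category.comp_id (X := x) (Y := x) a, Category.id_comp (X := x) (Y := x) a⟩⟩

/-- The element `one` is picked by choice; uniqueness of identity elements pins it down. -/
theorem FibredCStarCategory.one_fellBundle (C : Type u) [Category.{u} C] [TopologicalSpace C]
    [FibredCStarCategory C] (h : (FibredCStarCategory.fellBundle C).IsUnital) (x : C) :
    (FibredCStarCategory.fellBundle C).one h x = 𝟙 x :=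
  ((FibredCStarCategory.fellBundle C).one_isIdentity h x).eq
    fun a => ⟨Category.comp_id (X := x) (Y := x) a, Category.id_comp (X := x) (Y := x) a⟩

theorem FibredCStarCategory.isSaturated_fellBundle (C : Type u) [Category.{u} C]
    [TopologicalSpace C] [FibredCStarCategory C] (h : CStarCategory.IsFull C) :
    (FibredCStarCategory.fellBundle C).IsSaturated := by
  refine FellBundle.isSaturated_of_full _ (isUnital_fellBundle C) fun x y => ?_
  refine (h x y).mono (Submodule.span_mono ?_)
  rintro _ ⟨p, rfl⟩
  exact ⟨(p.2, p.1), rfl⟩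

namespace SpectralCStarCategory

variable {P : ∀ (M : Type u) [TopologicalSpace M], Prop} (D : SpectralCStarCategory P)

/-- Self-adjointness makes `r ∘ σ` an involution, hence its own continuous inverse. -/
theorem ran_ran_σ (x : D.Ob) : (D.σ (D.σ x).ran).ran = x := by
  rw [D.selfAdjoint_σ]
  exact D.dom_σ x

/-- The bisection given by the ranges of the section. -/
def bisection : D.Ob ≃ₜ D.Ob where
  toFun := fun x => (D.σ x).ran
  invFun := fun x => (D.σ x).ran
  left_inv := D.ran_ran_σ
  right_inv := D.ran_ran_σ
  continuous_toFun :=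
    continuous_fst.comp (FibredCStarCategory.banach.continuous_proj.comp D.continuous_σ)
  continuous_invFun :=
    continuous_fst.comp (FibredCStarCategory.banach.continuous_proj.comp D.continuous_σ)

theorem exists_lift (x : D.Ob) :
    ∃ e : HomFam D.Ob (D.bisection x, x), (⟨(D.bisection x, x), e⟩ : Tot (HomFam D.Ob)) = D.σ x := by
  have key : ∀ t : Tot (HomFam D.Ob), t.dom = x →
      ∃ e : HomFam D.Ob (t.ran, x), (⟨(t.ran, x), e⟩ : Tot (HomFam D.Ob)) = t := by
    rintro ⟨⟨y, z⟩, a⟩ rfl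
    exact ⟨a, rfl⟩
  exact key (D.σ x) (D.dom_σ x)

/-- Every spectral C*-category comes from a Fell bundle triple. -/
theorem exists_triple : ∃ T : FellBundleTriple P, Nonempty ((FellBundleTriple.toSpectral P).obj T ≅ D) := by
  let E := FibredCStarCategory.fellBundle D.Ob
  have hE : E.IsUnital := FibredCStarCategory.isUnital_fellBundle D.Ob
  choose e he using D.exists_lift
  have hc : Continuous fun x => (⟨(D.bisection x, x), e x⟩ : Tot E.Fib) :=
    D.continuous_σ.congr fun x => (he x).symm
  have hcons : ∀ x, (⟨(D.bisection (D.bisection x), D.bisection x), e (D.bisection x)⟩ : Tot E.Fib) =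
      E.totAdj ⟨(D.bisection x, x), e x⟩ := fun x => by
    have h1 : (⟨(D.bisection (D.bisection x), D.bisection x), e (D.bisection x)⟩ :
      Tot (HomFam D.Ob)) = (⟨(D.bisection x, x), e x⟩ : Tot (HomFam D.Ob)).star := by
      rw [he, he]
      exact D.selfAdjoint_σ x
    exact h1
  -- The adjoints `e_x*` appear because consistency rewrites `h(φ x, z) = e_x f(x, z)` as `h(x, z) =
  -- e_x* f(φ x, z)`.
  obtain ⟨R, B, hB⟩ := E.exists_representation hE D.bisection D.ran_ran_σ
    (fun x => E.adj (e x)) (E.continuous_adj.comp hc)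
  let T : FellBundleTriple P :=
    { M := D.Ob
      base_mem := D.base_mem
      E := E
      unital := hE
      saturated := FibredCStarCategory.isSaturated_fellBundle D.Ob D.full
      R := R
      L :=
        { φ := D.bisection
          lift := e
          continuous_lift := hc
          consistent := hcons
          PL := B
          extends_lift := fun f h hh =>
            hB f h ((FellBundle.forall_eq_mul_iff_of_consistent hcons).1 hh) } }
  have hone : ∀ x, E.one hE x = 𝟙 x := FibredCStarCategory.one_fellBundle D.Ob hE
  -- Both directions of the isomorphism are the identity on objects and morphisms; what needs proof
  -- is that `one` is `𝟙` and that `e` is `σ`.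
  let F : SpectralCStarCategory.Hom ((FellBundleTriple.toSpectral P).obj T) D :=
    { functor :=
        { obj := fun x => x
          map := fun {x y} a => a
          map_id := hone
          map_comp := fun _ _ => rfl }
      continuous_obj := continuous_id
      continuous_map := continuous_id
      map_add := fun _ _ => rfl
      map_smul := fun _ _ => rfl
      map_adj := fun _ => rfl
      map_σ := he }
  let G : SpectralCStarCategory.Hom D ((FellBundleTriple.toSpectral P).obj T) :=
    { functor :=
        { obj := fun x => x
          map := fun {x y} a => a
          map_id := fun x => (hone x).symm
          map_comp := fun _ _ => rfl }
      continuous_obj := continuous_id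
      continuous_map := continuous_id
      map_add := fun _ _ => rfl
      map_smul := fun _ _ => rfl
      map_adj := fun _ => rfl
      map_σ := fun x => (he x).symm }
  exact ⟨T, ⟨⟨F, G, rfl, rfl⟩⟩⟩

end SpectralCStarCategory

theorem mainTheorem2 (P : ∀ (M : Type u) [TopologicalSpace M], Prop) :
    (FellBundleTriple.toSpectral P).IsEquivalence ∧
      ∀ (T : FellBundleTriple P) (L L' : T.E.PathLifting T.R), L.φ = L'.φ →
        (L.PL = L'.PL ↔ ∀ x : T.M, L.arrow x = L'.arrow x) := by
  refine ⟨?_, fun T L L' h => L.eq_iff T.unital L' h⟩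
  have : (FellBundleTriple.toSpectral P).EssSurj := ⟨fun D => D.exists_triple⟩
  exact {}
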